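/- Let $\mathcal X$ be a nonempty compact metric space with distance $d$, and let $\mathcal M^+(\mathcal X)$ be the set of finite positive Borel measures on $\mathcal X$ (including $0$), with total mass $m(\alpha)=\alpha(\mathcal X)$. Let $C:\mathcal X\times\mathcal X\to\mathbb R$ be a cost that is symmetric, satisfies $C(x,x)=0$ for all $x$, and is $\gamma$-Lipschitz: $|C(x,z)-C(y,z)|\le\gamma\, d(x,y)$ for all $x,y,z$. Let $\varepsilon>0$ and assume that the kernel $k_\varepsilon=e^{-C/\varepsilon}$ is positive, i.e. $\iint k_\varepsilon(x,y)\,d\sigma(x)\,d\sigma(y)\ge 0$ for every finite signed measure $\sigma$ on $\mathcal X$, and universal, i.e. the linear span of $\{k_\varepsilon(\cdot,y): y\in\mathcal X\}$ is dense in $\mathcal C(\mathcal X)$ for the uniform norm. An entropy function is a convex, lower semicontinuous $\phi:[0,\infty)\to[0,\infty]$ with $\phi(1)=0$; put $\phi'_\infty=\lim_{p\to\infty}\phi(p)/p$. For finite positive measures with Lebesgue decomposition $\mu=\frac{d\mu}{d\nu}\nu+\mu^\perp$, let $D_\phi(\mu|\nu)=\int\phi\big(\frac{d\mu}{d\nu}\big)\,d\nu+\phi'_\infty\,\mu^\perp(\mathcal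 X)$ (with $\infty\cdot 0=0$), and let $\mathrm{KL}$ be the divergence obtained in the same way (on $\mathcal X^2$) from $p\log p-p+1$. For $\alpha,\beta\in\mathcal M^+(\mathcal X)$ define, with values in $(-\infty,+\infty]$, $$\mathrm{OT}_\varepsilon(\alpha,\beta)=\inf_{\pi\in\mathcal M^+(\mathcal X^2)}\int C\,d\pi+D_\phi(\pi_1|\alpha)+D_\phi(\pi_2|\beta)+\varepsilon\,\mathrm{KL}(\pi|\alpha\otimes\beta),$$ where $\pi_1,\pi_2$ are the marginals of $\pi$, and $$S_\varepsilon(\alpha,\beta)=\mathrm{OT}_\varepsilon(\alpha,\beta)-\tfrac12\mathrm{OT}_\varepsilon(\alpha,\alpha)-\tfrac12\mathrm{OT}_\varepsilon(\beta,\beta)+\tfrac{\varepsilon}{2}\big(m(\alpha)-m(\beta)\big)^2 .$$ Then for every entropy function $\phi$: (i) $S_\varepsilon(\alpha,\beta)\ge 0$ for all $\alpha,\beta\in\mathcal M^+(\mathcal X)$; (ii) $S_\varepsilon(\alpha,\beta)=0$ if and only if $\alpha=\beta$; (iii) $S_\varepsilon(\cdot,\beta)$ is convex on $\mathcal M^+(\mathcal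 X)$ for each $\beta$, and $S_\varepsilon(\alpha,\cdot)$ is convex on $\mathcal M^+(\mathcal X)$ for each $\alpha$. Joint convexity fails in general: for every such $\mathcal X$, $C$ and $\varepsilon$ there is an entropy function $\phi$ for which $(\alpha,\beta)\mapsto S_\varepsilon(\alpha,\beta)$ is not jointly convex. -/

import Mathlib

open MeasureTheory Filter Topology Set
open scoped NNReal ENNReal

noncomputable section

namespace UnbalancedOT

/-- An entropy function `φ : [0,∞) → [0,∞]`: convex, lower semicontinuous, with `φ 1 = 0`. -/
structure IsEntropyFunction (φ : ℝ≥0 → ℝ≥0∞) : Prop where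
  convexOn : ConvexOn ℝ≥0 univ φ
  lowerSemicontinuous : LowerSemicontinuous φ
  map_one : φ 1 = 0

/-- The recession constant `lim_{p → ∞} φ(p) / p ∈ [0,∞]`. For an entropy function the limit
exists, see `tendsto_recession`, so that it is equal to the upper limit. -/
def recession (φ : ℝ≥0 → ℝ≥0∞) : ℝ≥0∞ :=
  limsup (fun p : ℝ≥0 => φ p / (p : ℝ≥0∞)) atTop

/-- The Csiszár divergence `D_φ(μ|ν) = ∫ φ(dμ/dν) dν + φ'_∞ · μ^⊥(Y)`, where
`μ = (dμ/dν) ν + μ^⊥` is the Lebesgue decomposition; `∞ * 0 = 0` in `ℝ≥0∞`. -/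
def csiszarDiv {Y : Type*} [MeasurableSpace Y] (φ : ℝ≥0 → ℝ≥0∞) (μ ν : Measure Y) : ℝ≥0∞ :=
  (∫⁻ y, φ (μ.rnDeriv ν y).toNNReal ∂ν) + recession φ * (μ.singularPart ν) univ

variable {X : Type*} [MeasurableSpace X]

/-- The primal objective
`∫ C dπ + D_φ(π₁|α) + D_φ(π₂|β) + ε KL(π | α ⊗ β)` of a transport plan `π`, with values in
`(-∞, ∞]`. Mathlib's `klDiv μ ν` is the Csiszár divergence of `p log p - p + 1` for finite
measures (it contains the mass terms `ν(Y) - μ(Y)`). -/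
def otObjective (C : X → X → ℝ) (φ : ℝ≥0 → ℝ≥0∞) (ε : ℝ) (α β : FiniteMeasure X)
    (π : FiniteMeasure (X × X)) : EReal :=
  ((∫ z, C z.1 z.2 ∂(π : Measure (X × X)) : ℝ) : EReal) +
    ((csiszarDiv φ (π : Measure (X × X)).fst (α : Measure X) +
      csiszarDiv φ (π : Measure (X × X)).snd (β : Measure X) +
      ENNReal.ofReal ε * InformationTheory.klDiv (π : Measure (X × X))
        ((α : Measure X).prod (β : Measure X)) : ℝ≥0∞) : EReal)

/-- The regularized unbalanced optimal transport cost `OT_ε(α, β)`. -/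
def otCost (C : X → X → ℝ) (φ : ℝ≥0 → ℝ≥0∞) (ε : ℝ) (α β : FiniteMeasure X) : EReal :=
  ⨅ π : FiniteMeasure (X × X), otObjective C φ ε α β π

/-- The unbalanced Sinkhorn divergence
`S_ε(α,β) = OT_ε(α,β) - OT_ε(α,α)/2 - OT_ε(β,β)/2 + (ε/2) (m(α) - m(β))²`. -/
def sinkhornDiv (C : X → X → ℝ) (φ : ℝ≥0 → ℝ≥0∞) (ε : ℝ) (α β : FiniteMeasure X) : EReal :=
  otCost C φ ε α β
    - ((1 / 2 : ℝ) : EReal) * otCost C φ ε α α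
    - ((1 / 2 : ℝ) : EReal) * otCost C φ ε β β
    + ((ε / 2 * ((α.mass : ℝ) - (β.mass : ℝ)) ^ 2 : ℝ) : EReal)

/-- The Gibbs kernel `k_ε(x,y) = exp(-C(x,y)/ε)`. -/
def gibbsKernel (C : X → X → ℝ) (ε : ℝ) : X → X → ℝ := fun x y => Real.exp (-C x y / ε)

/-- A kernel is positive if `‖σ‖_k² = ∫∫ k(x,y) dσ(x) dσ(y) ≥ 0` for every signed measure `σ`. -/
def IsPositiveKernel (k : X → X → ℝ) : Prop :=
  ∀ σ : SignedMeasure X, 0 ≤ ∫ᵛ y, (∫ᵛ x, k x y ∂•σ) ∂•σ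

/-- A kernel is universal if the functions `x ↦ k(x,y)`, `y ∈ X`, span a dense linear subspace
of the space of continuous functions with the uniform norm. -/
def IsUniversalKernel {X : Type*} [TopologicalSpace X] [CompactSpace X] (k : X → X → ℝ) : Prop :=
  Dense (Submodule.span ℝ {f : C(X, ℝ) | ∃ y : X, ∀ x : X, f x = k x y} : Set C(X, ℝ))

/-- For an entropy function, `φ(p)/p` converges to the recession constant. -/
theorem tendsto_recession {φ : ℝ≥0 → ℝ≥0∞} (hφ : IsEntropyFunction φ) :
    Tendsto (fun p : ℝ≥0 => φ p / (p : ℝ≥0∞)) atTop (𝓝 (recession φ)) := by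
  have key : ∀ p q : ℝ≥0, 1 ≤ p → p ≤ q → φ p / (p : ℝ≥0∞) ≤ φ q / (q : ℝ≥0∞) := by
    intro p q hp hpq
    have hp0 : (p : ℝ≥0∞) ≠ 0 := by
      exact_mod_cast (lt_of_lt_of_le one_pos hp).ne'
    rcases hp.eq_or_lt with rfl | hp1
    · simp [hφ.map_one]
    have hq1 : 1 < q := hp1.trans_le hpq
    have hq0 : q ≠ 0 := (one_pos.trans hq1).ne'
    have hq1' : (0 : ℝ) < (q : ℝ) - 1 := sub_pos.2 (by exact_mod_cast hq1)
    have hle : (p : ℝ) ≤ q := by exact_mod_cast hpq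
    have h1 : (1 : ℝ) < p := by exact_mod_cast hp1
    set a : ℝ≥0 := ⟨((p : ℝ) - 1) / ((q : ℝ) - 1), div_nonneg (by linarith) hq1'.le⟩ with ha
    set b : ℝ≥0 := ⟨((q : ℝ) - p) / ((q : ℝ) - 1), div_nonneg (by linarith) hq1'.le⟩ with hb
    have haR : (a : ℝ) = ((p : ℝ) - 1) / ((q : ℝ) - 1) := rfl
    have hbR : (b : ℝ) = ((q : ℝ) - p) / ((q : ℝ) - 1) := rfl
    have hab : a + b = 1 := by
      apply NNReal.eq
      rw [NNReal.coe_add, haR, hbR, NNReal.coe_one]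
      field_simp
      ring
    have hcomb : a • q + b • (1 : ℝ≥0) = p := by
      apply NNReal.eq
      rw [smul_eq_mul, smul_eq_mul, NNReal.coe_add, NNReal.coe_mul, NNReal.coe_mul, haR, hbR,
        NNReal.coe_one]
      field_simp
      ring
    have hconv := hφ.convexOn.2 (mem_univ q) (mem_univ 1) (zero_le : 0 ≤ a) (zero_le : 0 ≤ b) hab
    rw [hcomb, hφ.map_one, smul_zero, add_zero, ENNReal.smul_def, smul_eq_mul] at hconv
    have hapq : a ≤ p / q := by
      rw [← NNReal.coe_le_coe, haR, NNReal.coe_div, div_le_div_iff₀ hq1' (by linarith)]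
      nlinarith
    rw [ENNReal.div_le_iff hp0 ENNReal.coe_ne_top]
    calc φ p ≤ (a : ℝ≥0∞) * φ q := hconv
      _ ≤ ((p / q : ℝ≥0) : ℝ≥0∞) * φ q := by gcongr
      _ = φ q / q * p := by
        rw [ENNReal.coe_div hq0, div_eq_mul_inv, div_eq_mul_inv]
        ring
  have hmono : Monotone fun p : ℝ≥0 => φ (max p 1) / ((max p 1 : ℝ≥0) : ℝ≥0∞) :=
    fun p q hpq => key _ _ (le_max_right _ _) (max_le_max_right 1 hpq)
  have ht : Tendsto (fun p : ℝ≥0 => φ p / (p : ℝ≥0∞)) atTop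
      (𝓝 (⨆ p : ℝ≥0, φ (max p 1) / ((max p 1 : ℝ≥0) : ℝ≥0∞))) := by
    refine (tendsto_atTop_iSup hmono).congr' ?_
    filter_upwards [eventually_ge_atTop (1 : ℝ≥0)] with p hp
    rw [max_eq_left hp]
  rw [recession, ht.limsup_eq]
  exact ht

end UnbalancedOT

end

/-! Everything rests on Fenchel duality. Writing `-φ^*(-f) = inf_q (φ q + f q)`, the dual of
`OT_ε(α,β)` maximizes `∫ -φ^*(-f) dα + ∫ -φ^*(-g) dβ + ε ∫ (1 - exp((f+g-C)/ε)) dα⊗β`. Weak duality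
(`dualValue_le_otCost`) needs no optimality. Equality (`otCost_le_dualValue`) holds once the plan
with density `exp((f+g-C)/ε)` has marginal densities at which `-f` and `-g` are subgradients of `φ`.
A finite KL term forces `π ≪ α⊗β`, so the recession constant never enters.

For `OT_ε(α,α)` with `α ≠ 0` a symmetric optimal potential `f = g` is a fixed point of a map that is
nonexpansive in the uniform norm (`exists_symmetric_potential`). Put `u_α = exp(f_α/ε) α` and let
`⟨u,v⟩` be the energy of the kernel `k_ε`. The dual value becomes an expression in `⟨u,v⟩` and the
masses. Inserting the suboptimal pair `(f_α, f_β)` into the dual of `OT_ε(α,β)`, all integrals and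
mass terms cancel and leave `S_ε(α,β) ≥ (ε/2) ‖u_α - u_β‖²` (`energy_le_sinkhornDiv`). Positivity
follows. If `S_ε = 0`, universality gives `u_α = u_β`; the scalar optimality equations of the two
potentials then coincide, so `f_α = f_β` and `α = β`.

For convexity, `S_ε(α,β)` is `OT_ε(α,β)`, convex in `α` by joint convexity of Csiszár divergences,
minus half of `OT_ε(α,α) - ε m(α)²`, plus terms affine in `α`. The subtracted function is concave
(`dualValue_self_concave`): it is a maximum of `2 ∫ -φ^*(-f) dα - ε ‖exp(f/ε) α‖²`, and potentials
of two measures can be averaged pointwise.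

Joint convexity already fails for multiples of one Dirac mass when `φ` is the indicator of `[0,1]`,
where all costs are explicit. -/

noncomputable section

namespace UnbalancedOT

open InformationTheory

/-! ### Scalar Fenchel duality for the entropy function -/

/-- Fenchel equality: `-f` is a subgradient of `φ` at `p`, and `ψ` is the minimum of
`q ↦ φ q + f * q`, which is attained at `p`. -/
structure IsPotential (φ : ℝ≥0 → ℝ≥0∞) (p f ψ : ℝ) : Prop where
  nonneg : 0 ≤ ψ - f * p
  map_eq : φ p.toNNReal = ENNReal.ofReal (ψ - f * p)
  le_map : ∀ q : ℝ≥0, ENNReal.ofReal (ψ - f * q) ≤ φ q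

/-- Monotonicity of the subdifferential of `φ`: add the two subgradient inequalities, each tested at
the other point. -/
theorem IsPotential.mul_nonpos {φ : ℝ≥0 → ℝ≥0∞} {p₁ f₁ ψ₁ p₂ f₂ ψ₂ : ℝ}
    (h₁ : IsPotential φ p₁ f₁ ψ₁) (h₂ : IsPotential φ p₂ f₂ ψ₂) (hp₁ : 0 ≤ p₁) (hp₂ : 0 ≤ p₂) :
    (f₁ - f₂) * (p₁ - p₂) ≤ 0 := by
  have a := h₁.le_map p₂.toNNReal
  have b := h₂.le_map p₁.toNNReal
  rw [h₂.map_eq, ENNReal.ofReal_le_ofReal_iff h₂.nonneg, Real.coe_toNNReal _ hp₂] at a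
  rw [h₁.map_eq, ENNReal.ofReal_le_ofReal_iff h₁.nonneg, Real.coe_toNNReal _ hp₁] at b
  nlinarith

/-- The solution `f` of the scalar optimality equation is nonincreasing in `s`, and `ε`-Lipschitz in
`log s`. If `f₁ - f₂ > c`, monotonicity forces `s₁ exp(f₁/ε) ≤ s₂ exp(f₂/ε)`, which bounds `f₁ - f₂`
by `c` after all. Uniqueness, Lipschitz regularity and nonexpansiveness all come from here. -/
theorem IsPotential.sub_le {φ : ℝ≥0 → ℝ≥0∞} {ε s₁ f₁ ψ₁ s₂ f₂ ψ₂ c : ℝ} (hε : 0 < ε)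
    (hs₁ : 0 < s₁) (hs₂ : 0 < s₂) (hc : 0 ≤ c)
    (h₁ : IsPotential φ (s₁ * Real.exp (f₁ / ε)) f₁ ψ₁)
    (h₂ : IsPotential φ (s₂ * Real.exp (f₂ / ε)) f₂ ψ₂)
    (hs : s₂ ≤ Real.exp (c / ε) * s₁) : f₁ - f₂ ≤ c := by
  by_contra! hlt
  have hf : 0 < f₁ - f₂ := hc.trans_lt hlt
  have hp : s₁ * Real.exp (f₁ / ε) - s₂ * Real.exp (f₂ / ε) ≤ 0 := by
    have := h₁.mul_nonpos h₂ (by positivity) (by positivity)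
    by_contra! h
    exact absurd this (not_le.2 (mul_pos hf h))
  have h3 : s₁ * Real.exp (f₁ / ε) ≤ s₁ * Real.exp ((c + f₂) / ε) := by
    calc s₁ * Real.exp (f₁ / ε) ≤ s₂ * Real.exp (f₂ / ε) := by linarith
      _ ≤ Real.exp (c / ε) * s₁ * Real.exp (f₂ / ε) := by gcongr
      _ = _ := by rw [add_div, Real.exp_add]; ring
  have h4 := Real.exp_le_exp.1 (le_of_mul_le_mul_left h3 hs₁)
  have h5 := (div_le_div_iff_of_pos_right hε).1 h4
  linarith

theorem isPotential_one {φ : ℝ≥0 → ℝ≥0∞} (hφ : IsEntropyFunction φ) : IsPotential φ 1 0 0 :=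
  ⟨by simp, by simp [hφ.map_one], by simp⟩

theorem IsPotential.le {φ : ℝ≥0 → ℝ≥0∞} {p f ψ : ℝ} (hφ : IsEntropyFunction φ)
    (h : IsPotential φ p f ψ) : ψ ≤ f := by
  have := h.le_map 1
  rw [hφ.map_one, nonpos_iff_eq_zero, ENNReal.ofReal_eq_zero] at this
  simpa using this

theorem IsPotential.eq_toReal {φ : ℝ≥0 → ℝ≥0∞} {p f ψ : ℝ} (h : IsPotential φ p f ψ) :
    ψ = (φ p.toNNReal).toReal + f * p := by
  rw [h.map_eq, ENNReal.toReal_ofReal h.nonneg]; ring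

theorem IsPotential.unique {φ : ℝ≥0 → ℝ≥0∞} {ε s f₁ ψ₁ f₂ ψ₂ : ℝ} (hε : 0 < ε) (hs : 0 < s)
    (h₁ : IsPotential φ (s * Real.exp (f₁ / ε)) f₁ ψ₁)
    (h₂ : IsPotential φ (s * Real.exp (f₂ / ε)) f₂ ψ₂) : f₁ = f₂ := by
  have a := h₁.sub_le hε hs hs le_rfl h₂ (by simp)
  have b := h₂.sub_le hε hs hs le_rfl h₁ (by simp)
  linarith

/-- Existence of the minimizer of `φ` plus a Kullback-Leibler term. -/
theorem exists_forall_add_klFun_le {φ : ℝ≥0 → ℝ≥0∞} (hφ : IsEntropyFunction φ) {ε s : ℝ}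
    (hε : 0 < ε) (hs : 0 < s) :
    ∃ p : ℝ≥0, ∀ q : ℝ≥0, φ p + ENNReal.ofReal (ε * s * klFun (p / s)) ≤
      φ q + ENNReal.ofReal (ε * s * klFun (q / s)) := by
  set G : ℝ≥0 → ℝ≥0∞ := fun p => φ p + ENNReal.ofReal (ε * s * klFun (p / s)) with hG
  have hlsc : LowerSemicontinuous G := by
    refine hφ.lowerSemicontinuous.add (Continuous.lowerSemicontinuous ?_)
    refine ENNReal.continuous_ofReal.comp (continuous_const.mul (continuous_klFun.comp ?_))
    exact NNReal.continuous_coe.div_const s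
  have htend : Tendsto (fun q : ℝ≥0 => klFun (q / s)) atTop atTop :=
    tendsto_klFun_atTop.comp
      ((NNReal.tendsto_coe_atTop.2 tendsto_id).atTop_div_const hs)
  -- `φ` need not be coercive, but the KL term is: beyond `M` it alone exceeds the value of the
  -- objective at `1`, where `φ` vanishes.
  obtain ⟨M, hM⟩ := eventually_atTop.1 (htend.eventually_ge_atTop (klFun (1 / s)))
  obtain ⟨p, hp, hmin⟩ := LowerSemicontinuousOn.exists_isMinOn (s := Icc 0 (max M 1))
    ⟨0, by simp⟩ isCompact_Icc (hlsc.lowerSemicontinuousOn _)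
  refine ⟨p, fun q => ?_⟩
  by_cases hq : q ∈ Icc 0 (max M 1)
  · exact hmin hq
  · have hq' : max M 1 < q := by
      by_contra! h
      exact hq ⟨zero_le, h⟩
    have h1 : G p ≤ G 1 := hmin (show (1 : ℝ≥0) ∈ Icc 0 (max M 1) by simp)
    refine h1.trans ?_
    simp only [hG, hφ.map_one, zero_add]
    refine le_add_left (ENNReal.ofReal_le_ofReal ?_)
    have := hM q ((le_max_left _ _).trans hq'.le)
    simp only [NNReal.coe_one]
    gcongr

/-- The optimality equation is the first-order condition for minimizing `φ(q) + ε s klFun(q/s)`: the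
derivative of the smooth part at the minimizer `p` is `f = ε log(p/s)`, so `-f` is a subgradient of
`φ` at `p`. -/
theorem exists_isPotential {φ : ℝ≥0 → ℝ≥0∞} (hφ : IsEntropyFunction φ) {ε s : ℝ}
    (hε : 0 < ε) (hs : 0 < s) :
    ∃ f ψ : ℝ, IsPotential φ (s * Real.exp (f / ε)) f ψ := by
  obtain ⟨p, hp⟩ := exists_forall_add_klFun_le hφ hε hs
  set h : ℝ → ℝ := fun x => ε * s * klFun (x / s) with hh
  have hh0 : ∀ x, 0 ≤ x → 0 ≤ h x := fun x hx =>
    mul_nonneg (by positivity) (klFun_nonneg (by positivity))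
  have hfin : φ p ≠ ∞ := by
    have := hp 1
    rw [hφ.map_one, zero_add] at this
    exact ne_top_of_le_ne_top ENNReal.ofReal_ne_top (le_self_add.trans this)
  have hreal : ∀ q : ℝ≥0, φ q ≠ ∞ → (φ p).toReal + h p ≤ (φ q).toReal + h q := by
    intro q hq
    have h1 := ENNReal.toReal_mono (by finiteness) (hp q)
    rwa [ENNReal.toReal_add hfin ENNReal.ofReal_ne_top,
      ENNReal.toReal_add hq ENNReal.ofReal_ne_top,
      ENNReal.toReal_ofReal (show 0 ≤ ε * s * klFun (p / s) from hh0 _ p.2),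
      ENNReal.toReal_ofReal (show 0 ≤ ε * s * klFun (q / s) from hh0 _ q.2)] at h1
  -- Minimality of `p` along the segment towards `q`, with `φ` bounded by its chord; dividing by `l`
  -- and letting `l → 0` gives the subgradient inequality.
  have hsec : ∀ q : ℝ≥0, φ q ≠ ∞ → ∀ l : ℝ, 0 < l → l < 1 →
      l * ((φ p).toReal - (φ q).toReal) ≤ h (p + l * (q - p)) - h p := by
    intro q hq l hl0 hl1
    lift l to ℝ≥0 using hl0.le
    have hl1' : l ≤ 1 := by exact_mod_cast hl1.le
    have hc := hφ.convexOn.2 (mem_univ q) (mem_univ p) (zero_le : 0 ≤ l)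
      (zero_le : 0 ≤ 1 - l) (add_tsub_cancel_of_le hl1')
    simp only [ENNReal.smul_def, smul_eq_mul] at hc
    have hne : (l : ℝ≥0∞) * φ q + ((1 - l : ℝ≥0) : ℝ≥0∞) * φ p ≠ ∞ := by finiteness
    have h1 := hreal _ (ne_top_of_le_ne_top hne hc)
    have h2 := ENNReal.toReal_mono hne hc
    rw [ENNReal.toReal_add (by finiteness) (by finiteness), ENNReal.toReal_mul,
      ENNReal.toReal_mul] at h2
    simp only [ENNReal.coe_toReal, NNReal.coe_sub hl1', NNReal.coe_one] at h2
    have h3 : ((l * q + (1 - l) * p : ℝ≥0) : ℝ) = p + l * (q - p) := by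
      push_cast [NNReal.coe_sub hl1']; ring
    rw [h3] at h1
    nlinarith
  -- `klFun` has slope `-∞` at `0`, so the minimizer is not `0`: a small step towards `1` would
  -- lower the objective. The bound `l ≤ s` makes `log(l/s)` nonpositive.
  have hp0 : (0 : ℝ) < p := by
    by_contra! hneg
    have hpz : (p : ℝ) = 0 := le_antisymm hneg p.2
    have hl : 0 < min (1 / 2) s := by positivity
    have h1 := hsec 1 (by simp [hφ.map_one]) (min (1 / 2) s) hl
      ((min_le_left _ _).trans_lt (by norm_num))
    simp only [hh, hpz, hφ.map_one, klFun_apply, NNReal.coe_one] at h1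
    simp only [ENNReal.toReal_zero, sub_zero, mul_one, zero_add, zero_div, zero_mul] at h1
    set l := min (1 / 2) s
    have hlog : Real.log (l / s) ≤ 0 :=
      Real.log_nonpos (by positivity) ((div_le_one hs).2 (min_le_right _ _))
    have h2 : ε * s * (l / s * Real.log (l / s) + 1 - l / s) - ε * s =
        ε * l * Real.log (l / s) - ε * l := by field_simp; ring
    rw [h2] at h1
    have h3 : 0 ≤ l * (φ p).toReal := by positivity
    have h4 : ε * l * Real.log (l / s) ≤ 0 := mul_nonpos_of_nonneg_of_nonpos (by positivity) hlog
    have h5 : 0 < ε * l := by positivity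
    linarith
  set f := ε * Real.log (p / s) with hf
  have hexp : s * Real.exp (f / ε) = p := by
    rw [hf, mul_div_cancel_left₀ _ hε.ne', Real.exp_log (by positivity)]
    field_simp
  have hder : HasDerivAt h f p := by
    have h1 : HasDerivAt (fun x : ℝ => x / s) (1 / s) p := (hasDerivAt_id _).div_const s
    have h2 := ((hasDerivAt_klFun (x := p / s) (by positivity)).comp (p : ℝ) h1).const_mul (ε * s)
    convert! h2 using 1
    rw [hf]; field_simp
  have hsub : ∀ q : ℝ≥0, φ q ≠ ∞ → (φ p).toReal - (φ q).toReal ≤ f * (q - p) := by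
    intro q hq
    have h1 : HasDerivAt (fun l : ℝ => h (p + l * (q - p))) (f * (q - p)) 0 := by
      have h2 : HasDerivAt (fun l : ℝ => (p : ℝ) + l * (q - p)) (q - p) 0 := by
        simpa using ((hasDerivAt_id (0 : ℝ)).mul_const ((q : ℝ) - p)).const_add (p : ℝ)
      have h3 : HasDerivAt h f ((p : ℝ) + 0 * (q - p)) := by simpa using hder
      exact HasDerivAt.comp (h₂ := h) (0 : ℝ) h3 h2
    refine ge_of_tendsto h1.tendsto_slope_zero_right ?_
    filter_upwards [Ioo_mem_nhdsGT (show (0 : ℝ) < 1 by norm_num)] with l hl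
    have := hsec q hq l hl.1 hl.2
    simp only [zero_add, zero_mul, add_zero, smul_eq_mul]
    rw [inv_mul_eq_div, le_div_iff₀ hl.1]
    linarith
  refine ⟨f, (φ p).toReal + f * p, ?_⟩
  rw [hexp]
  refine ⟨by simp, by simp [hfin], fun q => ?_⟩
  by_cases hq : φ q = ∞
  · simp [hq]
  · rw [← ENNReal.ofReal_toReal hq]
    refine ENNReal.ofReal_le_ofReal ?_
    have := hsub q hq
    linarith

/-! ### Bounded measurable functions -/

/-- Bounded measurable real functions. -/
def BddMeasurable {Y : Type*} [MeasurableSpace Y] (f : Y → ℝ) : Prop :=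
  Measurable f ∧ ∃ M : ℝ, ∀ y, |f y| ≤ M

namespace BddMeasurable

variable {Y Z : Type*} [MeasurableSpace Y] [MeasurableSpace Z] {f g : Y → ℝ}

theorem integrable (hf : BddMeasurable f) (μ : Measure Y) [IsFiniteMeasure μ] :
    Integrable f μ := by
  obtain ⟨hm, M, hM⟩ := hf
  exact .of_bound hm.aestronglyMeasurable M (ae_of_all _ hM)

theorem const (c : ℝ) : BddMeasurable (fun _ : Y => c) :=
  ⟨measurable_const, |c|, fun _ => le_rfl⟩

theorem add (hf : BddMeasurable f) (hg : BddMeasurable g) :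
    BddMeasurable (fun y => f y + g y) := by
  obtain ⟨hm, M, hM⟩ := hf
  obtain ⟨hm', M', hM'⟩ := hg
  exact ⟨hm.add hm', M + M', fun y => (abs_add_le _ _).trans (add_le_add (hM y) (hM' y))⟩

theorem neg (hf : BddMeasurable f) : BddMeasurable (fun y => -f y) :=
  ⟨hf.1.neg, hf.2.imp fun _ h y => by rw [abs_neg]; exact h y⟩

theorem sub (hf : BddMeasurable f) (hg : BddMeasurable g) :
    BddMeasurable (fun y => f y - g y) := by
  simpa only [sub_eq_add_neg] using hf.add hg.neg

theorem mul (hf : BddMeasurable f) (hg : BddMeasurable g) :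
    BddMeasurable (fun y => f y * g y) := by
  obtain ⟨hm, M, hM⟩ := hf
  obtain ⟨hm', M', hM'⟩ := hg
  refine ⟨hm.mul hm', M * M', fun y => ?_⟩
  rw [abs_mul]
  exact mul_le_mul (hM y) (hM' y) (abs_nonneg _) ((abs_nonneg _).trans (hM y))

theorem div_const (hf : BddMeasurable f) (c : ℝ) : BddMeasurable (fun y => f y / c) := by
  simpa only [div_eq_mul_inv] using hf.mul (const c⁻¹)

theorem exp (hf : BddMeasurable f) : BddMeasurable (fun y => Real.exp (f y)) := by
  obtain ⟨hm, M, hM⟩ := hf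
  refine ⟨hm.exp, Real.exp M, fun y => ?_⟩
  rw [abs_of_pos (Real.exp_pos _)]
  exact Real.exp_le_exp.2 ((le_abs_self _).trans (hM y))

theorem comp {h : Z → Y} (hf : BddMeasurable f) (hh : Measurable h) :
    BddMeasurable (fun z => f (h z)) :=
  ⟨hf.1.comp hh, hf.2.imp fun _ hM z => hM (h z)⟩

theorem integral_right {F : Y × Z → ℝ} (hF : BddMeasurable F) (ν : Measure Z)
    [IsFiniteMeasure ν] : BddMeasurable (fun y => ∫ z, F (y, z) ∂ν) := by
  obtain ⟨hm, M, hM⟩ := hF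
  refine ⟨(StronglyMeasurable.integral_prod_right (f := fun y z => F (y, z)) (ν := ν)
    hm.stronglyMeasurable).measurable, M * ν.real univ,
    fun y => ?_⟩
  rw [← Real.norm_eq_abs]
  exact norm_integral_le_of_norm_le_const (ae_of_all _ fun z => hM (y, z))

theorem of_continuous [TopologicalSpace Y] [CompactSpace Y] [OpensMeasurableSpace Y]
    (hf : Continuous f) : BddMeasurable f := by
  refine ⟨hf.measurable, ?_⟩
  obtain ⟨M, hM⟩ := isCompact_univ.exists_bound_of_continuousOn hf.continuousOn
  exact ⟨M, fun y => hM y (mem_univ y)⟩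

end BddMeasurable

theorem ofReal_integral_le_lintegral {Y : Type*} [MeasurableSpace Y] {μ : Measure Y} {h : Y → ℝ}
    (hh : Integrable h μ) : ENNReal.ofReal (∫ y, h y ∂μ) ≤ ∫⁻ y, ENNReal.ofReal (h y) ∂μ := by
  rw [integral_eq_lintegral_pos_part_sub_lintegral_neg_part hh]
  refine (ENNReal.ofReal_le_ofReal (sub_le_self _ ENNReal.toReal_nonneg)).trans ?_
  exact ENNReal.ofReal_toReal_le

/-! ### Fenchel inequality and equality for Csiszár divergences -/

section Divergence

variable {Y : Type*} [MeasurableSpace Y] {φ : ℝ≥0 → ℝ≥0∞}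

theorem csiszarDiv_of_ac (φ : ℝ≥0 → ℝ≥0∞) {μ ν : Measure Y} (h : μ ≪ ν) :
    csiszarDiv φ μ ν = ∫⁻ y, φ (μ.rnDeriv ν y).toNNReal ∂ν := by
  simp [csiszarDiv, Measure.singularPart_eq_zero_of_ac h]

/-- The entropy function of the Kullback-Leibler divergence. -/
def klEntropy (p : ℝ≥0) : ℝ≥0∞ := ENNReal.ofReal (klFun p)

theorem klDiv_eq_csiszarDiv {μ ν : Measure Y} [IsFiniteMeasure μ] [IsFiniteMeasure ν]
    (h : μ ≪ ν) : klDiv μ ν = csiszarDiv klEntropy μ ν := by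
  rw [csiszarDiv_of_ac _ h, klDiv_eq_lintegral_klFun_of_ac h]
  rfl

/-- KL is put in the same Fenchel framework: the tangent line of `klFun` at `exp t` has slope `t`,
and the inequality reduces to `x + 1 ≤ exp x`. -/
theorem isPotential_klEntropy {t E : ℝ} (hE : E = Real.exp t) :
    IsPotential klEntropy E (-t) (1 - E) := by
  have key : ∀ q : ℝ, 0 ≤ q → 1 - E + t * q ≤ klFun q := by
    intro q hq
    rcases hq.eq_or_lt with rfl | hq
    · simp [klFun_zero, hE, Real.exp_nonneg]
    · have h1 := Real.add_one_le_exp (t - Real.log q)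
      rw [Real.exp_sub, Real.exp_log hq, le_div_iff₀ hq, ← hE] at h1
      rw [klFun_apply]
      nlinarith
  have h0 : 1 - E - -t * E = klFun E := by
    rw [klFun_apply, hE, Real.log_exp]; ring
  have hE0 : 0 ≤ E := hE ▸ (Real.exp_nonneg t)
  refine ⟨h0 ▸ klFun_nonneg hE0, ?_, fun q => ENNReal.ofReal_le_ofReal ?_⟩
  · rw [h0, klEntropy, Real.coe_toNNReal _ hE0]
  · have := key q q.2
    linarith

/-- Weak duality for a Csiszár divergence. -/
theorem ofReal_le_csiszarDiv {μ ν : Measure Y} [IsFiniteMeasure μ] [IsFiniteMeasure ν]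
    (hμν : μ ≪ ν) {f ψ : Y → ℝ} (hf : BddMeasurable f) (hψ : BddMeasurable ψ)
    (h : ∀ᵐ y ∂ν, ∀ q : ℝ≥0, ENNReal.ofReal (ψ y - f y * q) ≤ φ q) :
    ENNReal.ofReal (∫ y, ψ y ∂ν - ∫ y, f y ∂μ) ≤ csiszarDiv φ μ ν := by
  have hint : Integrable (fun y => (μ.rnDeriv ν y).toReal * f y) ν :=
    (integrable_toReal_rnDeriv_mul_iff hμν).2 (hf.integrable μ)
  rw [csiszarDiv_of_ac φ hμν, ← integral_toReal_rnDeriv_mul hμν,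
    ← integral_sub (hψ.integrable ν) hint]
  refine (ofReal_integral_le_lintegral ((hψ.integrable ν).sub hint)).trans
    (lintegral_mono_ae ?_)
  filter_upwards [h] with y hy
  change ENNReal.ofReal (ψ y - (μ.rnDeriv ν y).toReal * f y) ≤ _
  rw [mul_comm]
  exact hy _

/-- The equality case of `ofReal_le_csiszarDiv`, obtained when the density sits where the affine
minorant touches `φ`. -/
theorem csiszarDiv_withDensity (ν : Measure Y) [IsFiniteMeasure ν]
    {p f ψ : Y → ℝ} (hp : BddMeasurable p) (hf : BddMeasurable f) (hψ : BddMeasurable ψ)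
    (h : ∀ᵐ y ∂ν, IsPotential φ (p y) (f y) (ψ y)) :
    csiszarDiv φ (ν.withDensity fun y => ENNReal.ofReal (p y)) ν =
      ENNReal.ofReal (∫ y, ψ y ∂ν - ∫ y, f y * p y ∂ν) := by
  rw [csiszarDiv_of_ac φ (withDensity_absolutelyContinuous _ _),
    ← integral_sub (hψ.integrable ν) ((hf.mul hp).integrable ν),
    ofReal_integral_eq_lintegral_ofReal ((hψ.sub (hf.mul hp)).integrable ν)]
  · refine lintegral_congr_ae ?_
    filter_upwards [h, ν.rnDeriv_withDensity hp.1.ennreal_ofReal] with y hy hy'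
    rw [hy', ← hy.map_eq, ENNReal.ofReal, ENNReal.toNNReal_coe]
  · filter_upwards [h] with y hy using hy.nonneg

end Divergence

/-! ### Duality for the regularized transport problem -/

section Duality

variable {X : Type*} [MeasurableSpace X] {C : X → X → ℝ} {φ : ℝ≥0 → ℝ≥0∞} {ε : ℝ}
  {α β : FiniteMeasure X} {f g ψ η : X → ℝ}

/-- The density `exp ((f(x) + g(y) - C(x,y)) / ε)` of the plan induced by two potentials. -/
def gibbsDensity (C : X → X → ℝ) (ε : ℝ) (f g : X → ℝ) (z : X × X) : ℝ :=
  Real.exp ((f z.1 + g z.2 - C z.1 z.2) / ε)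

/-- The value of the dual problem at the potentials `f`, `g`, where `ψ`, `η` are (lower bounds of)
the conjugates `-φ^*(-f)`, `-φ^*(-g)`. -/
def dualValue (C : X → X → ℝ) (ε : ℝ) (α β : FiniteMeasure X) (f g ψ η : X → ℝ) : ℝ :=
  ∫ x, ψ x ∂(α : Measure X) + ∫ y, η y ∂(β : Measure X) +
    ε * ∫ z, (1 - gibbsDensity C ε f g z) ∂((α : Measure X).prod (β : Measure X))

theorem bddMeasurable_gibbsDensity (hC : BddMeasurable fun z : X × X => C z.1 z.2)
    (hf : BddMeasurable f) (hg : BddMeasurable g) : BddMeasurable (gibbsDensity C ε f g) :=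
  (((hf.comp measurable_fst).add (hg.comp measurable_snd)).sub hC).div_const ε |>.exp

theorem fst_ac_of_ac_prod {μ ν : Measure X} [SFinite ν] {π : Measure (X × X)}
    (h : π ≪ μ.prod ν) : π.fst ≪ μ :=
  (h.map measurable_fst).trans Measure.quasiMeasurePreserving_fst.absolutelyContinuous

theorem snd_ac_of_ac_prod {μ ν : Measure X} [SFinite μ] [SFinite ν] {π : Measure (X × X)}
    (h : π ≪ μ.prod ν) : π.snd ≪ ν :=
  (h.map measurable_snd).trans Measure.quasiMeasurePreserving_snd.absolutelyContinuous

theorem integral_fst_measure {π : Measure (X × X)} (hf : BddMeasurable f) :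
    ∫ x, f x ∂π.fst = ∫ z, f z.1 ∂π :=
  integral_map measurable_fst.aemeasurable hf.1.aestronglyMeasurable

theorem integral_snd_measure {π : Measure (X × X)} (hf : BddMeasurable f) :
    ∫ x, f x ∂π.snd = ∫ z, f z.2 ∂π :=
  integral_map measurable_snd.aemeasurable hf.1.aestronglyMeasurable

/-- The nonnegative part of the primal objective. -/
def objectiveDiv (φ : ℝ≥0 → ℝ≥0∞) (ε : ℝ) (α β : FiniteMeasure X) (π : FiniteMeasure (X × X)) :
    ℝ≥0∞ :=
  csiszarDiv φ (π : Measure (X × X)).fst (α : Measure X) +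
    csiszarDiv φ (π : Measure (X × X)).snd (β : Measure X) +
    ENNReal.ofReal ε * klDiv (π : Measure (X × X)) ((α : Measure X).prod (β : Measure X))

theorem otObjective_of_ne_top {π : FiniteMeasure (X × X)} (h : objectiveDiv φ ε α β π ≠ ∞) :
    otObjective C φ ε α β π = ((∫ z, C z.1 z.2 ∂(π : Measure (X × X)) +
      (objectiveDiv φ ε α β π).toReal : ℝ) : EReal) := by
  rw [EReal.coe_add, EReal.coe_ennreal_toReal h]
  rfl

theorem otObjective_of_eq_top {π : FiniteMeasure (X × X)} (h : objectiveDiv φ ε α β π = ∞) :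
    otObjective C φ ε α β π = ⊤ := by
  change (_ : EReal) + ((objectiveDiv φ ε α β π : ℝ≥0∞) : EReal) = ⊤
  rw [h, EReal.coe_ennreal_top, EReal.coe_add_top]

theorem ac_of_objectiveDiv_ne_top (hε : 0 < ε) {π : FiniteMeasure (X × X)}
    (h : objectiveDiv φ ε α β π ≠ ∞) :
    (π : Measure (X × X)) ≪ (α : Measure X).prod (β : Measure X) := by
  by_contra hac
  exact h (by simp [objectiveDiv, klDiv_of_not_ac hac, hε])

/-- Weak duality. -/
theorem dualValue_le_otCost (hε : 0 < ε) (hC : BddMeasurable fun z : X × X => C z.1 z.2)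
    (hf : BddMeasurable f) (hg : BddMeasurable g) (hψ : BddMeasurable ψ) (hη : BddMeasurable η)
    (hα : ∀ᵐ x ∂(α : Measure X), ∀ q : ℝ≥0, ENNReal.ofReal (ψ x - f x * q) ≤ φ q)
    (hβ : ∀ᵐ y ∂(β : Measure X), ∀ q : ℝ≥0, ENNReal.ofReal (η y - g y * q) ≤ φ q) :
    ((dualValue C ε α β f g ψ η : ℝ) : EReal) ≤ otCost C φ ε α β := by
  refine le_iInf fun π => ?_
  by_cases htop : objectiveDiv φ ε α β π = ∞
  · rw [otObjective_of_eq_top htop]; exact le_top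
  rw [otObjective_of_ne_top htop, EReal.coe_le_coe_iff]
  have hac := ac_of_objectiveDiv_ne_top hε htop
  have h1 := ofReal_le_csiszarDiv (fst_ac_of_ac_prod hac) hf hψ hα
  have h2 := ofReal_le_csiszarDiv (snd_ac_of_ac_prod hac) hg hη hβ
  have hE : BddMeasurable (gibbsDensity C ε f g) := bddMeasurable_gibbsDensity hC hf hg
  -- The KL term is tested with slope `(f + g - C)/ε`, so that the terms linear in `π` from the
  -- three divergences cancel `∫ C dπ`.
  have ht : BddMeasurable fun z : X × X => -((f z.1 + g z.2 - C z.1 z.2) / ε) :=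
    ((((hf.comp measurable_fst).add (hg.comp measurable_snd)).sub hC).div_const ε).neg
  have h3 := ofReal_le_csiszarDiv (φ := klEntropy) hac ht ((BddMeasurable.const 1).sub hE)
    (ae_of_all _ fun z => (isPotential_klEntropy rfl).le_map)
  rw [← klDiv_eq_csiszarDiv hac] at h3
  have hle : ENNReal.ofReal (∫ x, ψ x ∂(α : Measure X) - ∫ x, f x ∂(π : Measure (X × X)).fst) +
      ENNReal.ofReal (∫ x, η x ∂(β : Measure X) - ∫ x, g x ∂(π : Measure (X × X)).snd) +
      ENNReal.ofReal ε * ENNReal.ofReal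
        (∫ z, (1 - gibbsDensity C ε f g z) ∂((α : Measure X).prod (β : Measure X)) -
          ∫ z, -((f z.1 + g z.2 - C z.1 z.2) / ε) ∂(π : Measure (X × X))) ≤
      objectiveDiv φ ε α β π := by
    unfold objectiveDiv
    gcongr
  have hle' := ENNReal.toReal_mono htop hle
  rw [ENNReal.toReal_add (by finiteness) (by finiteness), ENNReal.toReal_add (by finiteness)
    (by finiteness), ENNReal.toReal_mul, ENNReal.toReal_ofReal hε.le, ENNReal.toReal_ofReal',
    ENNReal.toReal_ofReal', ENNReal.toReal_ofReal', integral_fst_measure hf,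
    integral_snd_measure hg] at hle'
  have e1 : ∫ z, -((f z.1 + g z.2 - C z.1 z.2) / ε) ∂(π : Measure (X × X)) =
      -((∫ z, f z.1 ∂(π : Measure (X × X)) + ∫ z, g z.2 ∂(π : Measure (X × X)) -
        ∫ z, C z.1 z.2 ∂(π : Measure (X × X))) / ε) := by
    have i1 := (hf.comp measurable_fst).integrable (π : Measure (X × X))
    have i2 := (hg.comp measurable_snd).integrable (π : Measure (X × X))
    rw [integral_neg, integral_div, integral_sub (((hf.comp measurable_fst).add
      (hg.comp measurable_snd)).integrable _) (hC.integrable _),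
      integral_add i1 i2]
  rw [e1] at hle'
  have m1 := le_max_left (∫ x, ψ x ∂(α : Measure X) - ∫ z, f z.1 ∂(π : Measure (X × X))) 0
  have m2 := le_max_left (∫ x, η x ∂(β : Measure X) - ∫ z, g z.2 ∂(π : Measure (X × X))) 0
  have m3 := mul_le_mul_of_nonneg_left (le_max_left
    (∫ z, (1 - gibbsDensity C ε f g z) ∂((α : Measure X).prod (β : Measure X)) -
      -((∫ z, f z.1 ∂(π : Measure (X × X)) + ∫ z, g z.2 ∂(π : Measure (X × X)) -
        ∫ z, C z.1 z.2 ∂(π : Measure (X × X))) / ε)) 0) hε.le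
  rw [mul_sub, mul_neg, mul_div_cancel₀ _ hε.ne'] at m3
  unfold dualValue
  linarith

/-- Optimal potentials give an upper bound on the primal problem. -/
theorem otCost_le_dualValue (hε : 0 < ε) (hC : BddMeasurable fun z : X × X => C z.1 z.2)
    (hf : BddMeasurable f) (hg : BddMeasurable g) (hψ : BddMeasurable ψ) (hη : BddMeasurable η)
    (hα : ∀ᵐ x ∂(α : Measure X),
      IsPotential φ (∫ y, gibbsDensity C ε f g (x, y) ∂(β : Measure X)) (f x) (ψ x))
    (hβ : ∀ᵐ y ∂(β : Measure X),
      IsPotential φ (∫ x, gibbsDensity C ε f g (x, y) ∂(α : Measure X)) (g y) (η y)) :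
    otCost C φ ε α β ≤ ((dualValue C ε α β f g ψ η : ℝ) : EReal) := by
  have hE : BddMeasurable (gibbsDensity C ε f g) := bddMeasurable_gibbsDensity hC hf hg
  have hE0 : ∀ z, 0 ≤ gibbsDensity C ε f g z := fun z => (Real.exp_pos _).le
  set ν : Measure (X × X) := (α : Measure X).prod (β : Measure X) with hν
  set πm : Measure (X × X) := ν.withDensity fun z => ENNReal.ofReal (gibbsDensity C ε f g z)
    with hπm
  have hfin : IsFiniteMeasure πm := isFiniteMeasure_withDensity_ofReal (hE.integrable ν).2
  set π : FiniteMeasure (X × X) := ⟨πm, hfin⟩ with hπ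
  have hint : ∀ h : X × X → ℝ, ∫ z, h z ∂πm = ∫ z, h z * gibbsDensity C ε f g z ∂ν := by
    intro h
    rw [hπm, integral_withDensity_eq_integral_toReal_smul hE.1.ennreal_ofReal
      (ae_of_all _ fun _ => ENNReal.ofReal_lt_top)]
    refine integral_congr_ae (ae_of_all _ fun z => ?_)
    simp only [smul_eq_mul]
    rw [ENNReal.toReal_ofReal (hE0 z), mul_comm]
  have hE' : BddMeasurable fun z : X × X => gibbsDensity C ε f g (z.2, z.1) :=
    hE.comp measurable_swap
  set p : X → ℝ := fun x => ∫ y, gibbsDensity C ε f g (x, y) ∂(β : Measure X) with hp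
  set r : X → ℝ := fun y => ∫ x, gibbsDensity C ε f g (x, y) ∂(α : Measure X) with hr
  have hpb : BddMeasurable p := hE.integral_right _
  have hrb : BddMeasurable r := hE'.integral_right _
  -- By Fubini the marginals of the candidate plan have exactly the densities at which `f` and `g`
  -- are assumed to be potentials.
  have hfst : πm.fst = (α : Measure X).withDensity fun x => ENNReal.ofReal (p x) := by
    ext s hs
    rw [Measure.fst_apply hs, withDensity_apply _ (measurable_fst hs), withDensity_apply _ hs]
    have e : (Prod.fst ⁻¹' s : Set (X × X)) = s ×ˢ univ := by ext; simp
    rw [e, hν, setLIntegral_prod _ hE.1.ennreal_ofReal.aemeasurable]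
    refine lintegral_congr fun x => ?_
    rw [hp, ofReal_integral_eq_lintegral_ofReal
      ((hE.comp measurable_prodMk_left).integrable _) (ae_of_all _ fun y => hE0 _),
      Measure.restrict_univ]
  have hsnd : πm.snd = (β : Measure X).withDensity fun x => ENNReal.ofReal (r x) := by
    ext s hs
    rw [Measure.snd_apply hs, withDensity_apply _ (measurable_snd hs), withDensity_apply _ hs]
    have e : (Prod.snd ⁻¹' s : Set (X × X)) = univ ×ˢ s := by ext; simp
    rw [e, hν, setLIntegral_prod_symm _ hE.1.ennreal_ofReal.aemeasurable]
    refine lintegral_congr fun x => ?_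
    rw [hr, ofReal_integral_eq_lintegral_ofReal
      ((hE.comp measurable_prodMk_right).integrable _) (ae_of_all _ fun y => hE0 _),
      Measure.restrict_univ]
  have ht : BddMeasurable fun z : X × X => -((f z.1 + g z.2 - C z.1 z.2) / ε) :=
    ((((hf.comp measurable_fst).add (hg.comp measurable_snd)).sub hC).div_const ε).neg
  have hkl : klDiv πm ν = ENNReal.ofReal (∫ z, (1 - gibbsDensity C ε f g z) ∂ν -
      ∫ z, -((f z.1 + g z.2 - C z.1 z.2) / ε) * gibbsDensity C ε f g z ∂ν) := by
    rw [klDiv_eq_csiszarDiv (withDensity_absolutelyContinuous _ _)]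
    exact csiszarDiv_withDensity ν hE ht ((BddMeasurable.const 1).sub hE)
      (ae_of_all _ fun z => isPotential_klEntropy rfl)
  have hd1 := csiszarDiv_withDensity (α : Measure X) hpb hf hψ hα
  have hd2 := csiszarDiv_withDensity (β : Measure X) hrb hg hη hβ
  have hobj : objectiveDiv φ ε α β π =
      ENNReal.ofReal (∫ x, ψ x ∂(α : Measure X) - ∫ x, f x * p x ∂(α : Measure X)) +
      ENNReal.ofReal (∫ x, η x ∂(β : Measure X) - ∫ x, g x * r x ∂(β : Measure X)) +
      ENNReal.ofReal ε * ENNReal.ofReal (∫ z, (1 - gibbsDensity C ε f g z) ∂ν -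
      ∫ z, -((f z.1 + g z.2 - C z.1 z.2) / ε) * gibbsDensity C ε f g z ∂ν) := by
    rw [← hd1, ← hd2, ← hkl, ← hfst, ← hsnd]
    rfl
  refine (iInf_le _ π).trans ?_
  rw [otObjective_of_ne_top (by rw [hobj]; finiteness), EReal.coe_le_coe_iff]
  have n1 : 0 ≤ ∫ x, ψ x ∂(α : Measure X) - ∫ x, f x * p x ∂(α : Measure X) := by
    rw [← integral_sub (hψ.integrable _) ((hf.mul hpb).integrable _)]
    exact integral_nonneg_of_ae (hα.mono fun x hx => hx.nonneg)
  have n2 : 0 ≤ ∫ x, η x ∂(β : Measure X) - ∫ x, g x * r x ∂(β : Measure X) := by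
    rw [← integral_sub (hη.integrable _) ((hg.mul hrb).integrable _)]
    exact integral_nonneg_of_ae (hβ.mono fun x hx => hx.nonneg)
  have n3 : 0 ≤ ∫ z, (1 - gibbsDensity C ε f g z) ∂ν -
      ∫ z, -((f z.1 + g z.2 - C z.1 z.2) / ε) * gibbsDensity C ε f g z ∂ν := by
    rw [← integral_sub (((BddMeasurable.const 1).sub hE).integrable _)
      ((ht.mul hE).integrable _)]
    exact integral_nonneg fun z => (isPotential_klEntropy (t := _) rfl).nonneg
  rw [hobj, ENNReal.toReal_add (by finiteness) (by finiteness), ENNReal.toReal_add (by finiteness)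
    (by finiteness), ENNReal.toReal_mul, ENNReal.toReal_ofReal n1, ENNReal.toReal_ofReal n2,
    ENNReal.toReal_ofReal n3, ENNReal.toReal_ofReal hε.le]
  have e1 : ∫ x, f x * p x ∂(α : Measure X) = ∫ z, f z.1 * gibbsDensity C ε f g z ∂ν := by
    rw [hν, integral_prod _ (((hf.comp measurable_fst).mul hE).integrable _)]
    simp only [integral_const_mul, hp]
  have e2 : ∫ x, g x * r x ∂(β : Measure X) = ∫ z, g z.2 * gibbsDensity C ε f g z ∂ν := by
    rw [hν, integral_prod_symm _ (((hg.comp measurable_snd).mul hE).integrable _)]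
    simp only [integral_const_mul, hr]
  have e3 : ∫ z, -((f z.1 + g z.2 - C z.1 z.2) / ε) * gibbsDensity C ε f g z ∂ν =
      -((∫ z, f z.1 * gibbsDensity C ε f g z ∂ν + ∫ z, g z.2 * gibbsDensity C ε f g z ∂ν -
        ∫ z, C z.1 z.2 * gibbsDensity C ε f g z ∂ν) / ε) := by
    have i1 := ((hf.comp measurable_fst).mul hE).integrable ν
    have i2 := ((hg.comp measurable_snd).mul hE).integrable ν
    rw [← integral_add i1 i2, ← integral_sub (((hf.comp measurable_fst).mul hE |>.add
      ((hg.comp measurable_snd).mul hE)).integrable ν) ((hC.mul hE).integrable _),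
      ← integral_div, ← integral_neg]
    refine integral_congr_ae (ae_of_all _ fun z => ?_)
    ring
  have e4 : ∫ z, C z.1 z.2 ∂(π : Measure (X × X)) =
      ∫ z, C z.1 z.2 * gibbsDensity C ε f g z ∂ν := hint _
  rw [e1, e2, e3, e4, mul_sub, mul_neg, mul_div_cancel₀ _ hε.ne']
  unfold dualValue
  linarith

end Duality

/-! ### Existence of a symmetric optimal potential -/

section SymmetricPotential

open scoped BoundedContinuousFunction

theorem continuous_cost {X : Type*} [MetricSpace X] {C : X → X → ℝ} {γ : ℝ}
    (hsymm : ∀ x y, C x y = C y x)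
    (hLip : ∀ x y z, |C x z - C y z| ≤ γ * dist x y) :
    Continuous fun z : X × X => C z.1 z.2 := by
  have h : ∀ z, LipschitzWith γ.toNNReal fun x => C x z := fun z =>
    LipschitzWith.of_dist_le_mul fun x y => (hLip x y z).trans
      (mul_le_mul_of_nonneg_right (Real.le_coe_toNNReal γ) dist_nonneg)
  refine (LipschitzWith.uncurry (f := C) h (Kβ := γ.toNNReal) fun x => ?_).continuous
  simpa only [hsymm] using h x

/-- `A` is not a contraction, but `θ • A` is for `θ < 1`. The fixed points of these damped maps lie
in one compact set of equi-Lipschitz, uniformly bounded functions, on which the displacement `dist f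
(A f)` attains its minimum; letting `θ → 1` shows that this minimum is `0`. -/
theorem exists_fixedPoint_of_nonexpansive {X : Type*} [MetricSpace X] [CompactSpace X]
    (A : (X →ᵇ ℝ) → (X →ᵇ ℝ))
    (hA : ∀ f g, dist (A f) (A g) ≤ dist f g) {L : ℝ≥0} {B : ℝ} (hB : 0 ≤ B)
    (hL : ∀ f x y, dist (A f x) (A f y) ≤ L * dist x y)
    (hbd : ∀ (f : X →ᵇ ℝ) (θ : ℝ), 0 ≤ θ → θ ≤ 1 → f = θ • A f → ∀ x, |f x| ≤ B) :
    ∃ f, A f = f := by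
  set K : Set (X →ᵇ ℝ) := {f | (∀ x y, dist (f x) (f y) ≤ L * dist x y) ∧ ∀ x, |f x| ≤ B} with hK
  have hcl : IsClosed K := by
    simp only [hK, Set.ofPred_and, Set.ofPred_forall]
    refine IsClosed.inter (isClosed_iInter fun x => isClosed_iInter fun y => ?_)
      (isClosed_iInter fun x => ?_)
    · exact isClosed_le ((continuous_eval_const x).dist
        (continuous_eval_const y)) continuous_const
    · exact isClosed_le (continuous_eval_const x).abs continuous_const
  have hcpt : IsCompact K := by
    refine BoundedContinuousFunction.arzela_ascoli₂ (Icc (-B) B) isCompact_Icc K hcl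
      (fun f x hf => abs_le.1 (hf.2 x)) ?_
    refine (LipschitzWith.uniformEquicontinuous _ L fun f => ?_).equicontinuous
    exact LipschitzWith.of_dist_le_mul f.2.1
  have hmem : ∀ θ : ℝ, 0 ≤ θ → θ < 1 → ∃ f ∈ K, f = θ • A f := by
    intro θ h0 h1
    lift θ to ℝ≥0 using h0
    have hc : ContractingWith θ (fun f : X →ᵇ ℝ => (θ : ℝ) • A f) := by
      refine ⟨by exact_mod_cast h1, LipschitzWith.of_dist_le_mul fun f g => ?_⟩
      rw [BoundedContinuousFunction.dist_le (by positivity)]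
      intro x
      change dist ((θ : ℝ) * A f x) (θ * A g x) ≤ _
      rw [Real.dist_eq, ← mul_sub, abs_mul, NNReal.abs_eq, ← Real.dist_eq]
      exact mul_le_mul_of_nonneg_left
        ((BoundedContinuousFunction.dist_coe_le_dist x).trans (hA f g)) θ.2
    have hfix : (θ : ℝ) • A hc.fixedPoint = hc.fixedPoint := hc.fixedPoint_isFixedPt
    set f : X →ᵇ ℝ := hc.fixedPoint
    refine ⟨f, ⟨fun x y => ?_, hbd f θ θ.2 h1.le hfix.symm⟩, hfix.symm⟩
    rw [← hfix]
    simp only [BoundedContinuousFunction.coe_smul, smul_eq_mul, Real.dist_eq]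
    rw [← mul_sub, abs_mul, NNReal.abs_eq]
    exact (mul_le_of_le_one_left (abs_nonneg _) h1.le).trans (hL f x y)
  have hcont : Continuous fun f => dist f (A f) :=
    continuous_id.dist (LipschitzWith.of_dist_le_mul (K := 1) (by simpa using hA)).continuous
  obtain ⟨f₀, hf₀, -⟩ := hmem 0 le_rfl one_pos
  obtain ⟨f, -, hmin⟩ := hcpt.exists_isMinOn ⟨f₀, hf₀⟩ hcont.continuousOn
  refine ⟨f, (dist_le_zero.1 ?_).symm⟩
  have hle : ∀ t : ℝ, 0 < t → t ≤ 1 / 2 → dist f (A f) ≤ t * (2 * B) := by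
    intro t h0 h1
    obtain ⟨g, hg, hgA⟩ := hmem (1 - t) (by linarith) (by linarith)
    refine (hmin hg).trans ?_
    rw [BoundedContinuousFunction.dist_le (by positivity)]
    intro x
    have hx : g x = (1 - t) * A g x := by
      conv_lhs => rw [hgA]
      rfl
    have h2 : |A g x| ≤ 2 * B := by
      have h3 := hg.2 x
      rw [hx, abs_mul, abs_of_nonneg (by linarith)] at h3
      nlinarith [abs_nonneg (A g x)]
    have h4 : g x - A g x = -(t * A g x) := by rw [hx]; ring
    rw [Real.dist_eq, h4, abs_neg, abs_mul, abs_of_pos h0]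
    gcongr
  have htend : Tendsto (fun t : ℝ => t * (2 * B)) (𝓝[>] 0) (𝓝 0) := by
    refine Tendsto.mono_left ?_ nhdsWithin_le_nhds
    have : Continuous fun t : ℝ => t * (2 * B) := by fun_prop
    simpa using this.tendsto 0
  refine ge_of_tendsto htend ?_
  filter_upwards [Ioc_mem_nhdsGT (show (0 : ℝ) < 1 / 2 by norm_num)] with t ht
  exact hle t ht.1 ht.2

variable {X : Type*} [MetricSpace X] [CompactSpace X] [MeasurableSpace X] [BorelSpace X]
  {C : X → X → ℝ} {γ ε : ℝ} {φ : ℝ≥0 → ℝ≥0∞}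

/-- The smoothed potential `∫ exp ((f(y) - C(x,y)) / ε) dα(y)`. -/
def expIntegral (C : X → X → ℝ) (ε : ℝ) (α : FiniteMeasure X) (f : X → ℝ) (x : X) : ℝ :=
  ∫ y, Real.exp ((f y - C x y) / ε) ∂(α : Measure X)

variable {α : FiniteMeasure X} {f g : X → ℝ}

theorem bddMeasurable_expIntegrand (hC : Continuous fun z : X × X => C z.1 z.2)
    (hf : Continuous f) (x : X) : BddMeasurable fun y => Real.exp ((f y - C x y) / ε) :=
  BddMeasurable.of_continuous (Real.continuous_exp.comp
    ((hf.sub (hC.comp (by fun_prop : Continuous fun y => (x, y)))).div_const ε))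

theorem expIntegral_le (hε : 0 < ε) (hC : Continuous fun z : X × X => C z.1 z.2)
    (hf : Continuous f) (hg : Continuous g) {x x' : X} {c : ℝ}
    (h : ∀ y, f y - C x y ≤ c + (g y - C x' y)) :
    expIntegral C ε α f x ≤ Real.exp (c / ε) * expIntegral C ε α g x' := by
  rw [expIntegral, expIntegral, ← integral_const_mul]
  refine integral_mono ((bddMeasurable_expIntegrand hC hf x).integrable _)
    (((bddMeasurable_expIntegrand hC hg x').integrable _).const_mul _) fun y => ?_
  simp only
  rw [← Real.exp_add, ← add_div]
  exact Real.exp_le_exp.2 (div_le_div_of_nonneg_right (h y) hε.le)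

theorem expIntegral_pos (hα : α ≠ 0) (hC : Continuous fun z : X × X => C z.1 z.2)
    (hf : Continuous f) (x : X) : 0 < expIntegral C ε α f x := by
  have : NeZero (α : Measure X) := ⟨fun h => hα (Subtype.ext h)⟩
  exact integral_exp_pos ((bddMeasurable_expIntegrand hC hf x).integrable _)

/-- With `T s` the solution of the scalar equation, a symmetric potential is a fixed point of `f ↦ T
(expIntegral C ε α f ·)`. By `IsPotential.sub_le` this map inherits the Lipschitz constant of the
cost and is nonexpansive. Asking for the equation at every `x`, not only `α`-almost everywhere, lets
potentials of different measures be compared later. -/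
theorem exists_symmetric_potential (hφ : IsEntropyFunction φ) (hε : 0 < ε)
    (hsymm : ∀ x y, C x y = C y x) (hdiag : ∀ x, C x x = 0)
    (hLip : ∀ x y z, |C x z - C y z| ≤ γ * dist x y) (hα : α ≠ 0) :
    ∃ f ψ : X → ℝ, Continuous f ∧ BddMeasurable ψ ∧
      ∀ x, IsPotential φ (expIntegral C ε α f x * Real.exp (f x / ε)) (f x) (ψ x) := by
  have hC := continuous_cost hsymm hLip
  have hT : ∀ s : ℝ, ∃ f ψ : ℝ, 0 < s → IsPotential φ (s * Real.exp (f / ε)) f ψ := by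
    intro s
    by_cases hs : 0 < s
    · obtain ⟨f, ψ, h⟩ := exists_isPotential hφ hε hs
      exact ⟨f, ψ, fun _ => h⟩
    · exact ⟨0, 0, fun h => absurd h hs⟩
  choose T Ψ hT using hT
  set L : ℝ≥0 := γ.toNNReal with hLdef
  have hLip' : ∀ x y z, |C x z - C y z| ≤ L * dist x y := fun x y z => (hLip x y z).trans
    (mul_le_mul_of_nonneg_right (Real.le_coe_toNNReal γ) dist_nonneg)
  have hTlip : ∀ (f : X →ᵇ ℝ) (x x' : X),
      dist (T (expIntegral C ε α f x)) (T (expIntegral C ε α f x')) ≤ L * dist x x' := by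
    intro f x x'
    have key : ∀ x x', T (expIntegral C ε α f x) - T (expIntegral C ε α f x') ≤ L * dist x x' := by
      intro x x'
      refine IsPotential.sub_le hε (expIntegral_pos hα hC f.continuous x)
        (expIntegral_pos hα hC f.continuous x') (by positivity)
        (hT _ (expIntegral_pos hα hC f.continuous x))
        (hT _ (expIntegral_pos hα hC f.continuous x'))
        (expIntegral_le hε hC f.continuous f.continuous fun y => ?_)
      have := (abs_le.1 (hLip' x x' y)).2
      linarith
    rw [Real.dist_eq, abs_sub_le_iff]
    exact ⟨key x x', by rw [dist_comm]; exact key x' x⟩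
  set A : (X →ᵇ ℝ) → (X →ᵇ ℝ) := fun f => BoundedContinuousFunction.mkOfCompact
    ⟨fun x => T (expIntegral C ε α f x), (LipschitzWith.of_dist_le_mul (hTlip f)).continuous⟩
    with hAdef
  have hAx : ∀ f x, A f x = T (expIntegral C ε α f x) := fun f x => rfl
  have hA : ∀ f g, dist (A f) (A g) ≤ dist f g := by
    intro f g
    rw [BoundedContinuousFunction.dist_le dist_nonneg]
    intro x
    have key : ∀ f g : X →ᵇ ℝ, T (expIntegral C ε α f x) - T (expIntegral C ε α g x) ≤ dist f g := by
      intro f g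
      refine IsPotential.sub_le hε (expIntegral_pos hα hC f.continuous x)
        (expIntegral_pos hα hC g.continuous x) dist_nonneg
        (hT _ (expIntegral_pos hα hC f.continuous x))
        (hT _ (expIntegral_pos hα hC g.continuous x))
        (expIntegral_le hε hC g.continuous f.continuous fun y => ?_)
      have := (abs_le.1 (BoundedContinuousFunction.dist_coe_le_dist (f := f) (g := g) y)).1
      linarith
    rw [hAx, hAx, Real.dist_eq, abs_sub_le_iff]
    exact ⟨key f g, by rw [dist_comm]; exact key g f⟩
  set m : ℝ := (α : Measure X).real univ with hm
  have hm0 : 0 < m := by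
    have : NeZero (α : Measure X) := ⟨fun h => hα (Subtype.ext h)⟩
    exact measureReal_univ_pos
  set R : ℝ := L * Metric.diam (univ : Set X) with hR
  have hR0 : 0 ≤ R := by positivity
  have hdR : ∀ x y : X, L * dist x y ≤ R := fun x y => mul_le_mul_of_nonneg_left
    (Metric.dist_le_diam_of_mem isCompact_univ.isBounded (mem_univ x) (mem_univ y)) L.2
  -- `2 * R` covers the oscillation of `f` plus the size of `C`; `ε |log m|` absorbs the total mass.
  set B : ℝ := 2 * R + ε * |Real.log m| with hBdef
  have hB0 : 0 ≤ B := by positivity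
  have hCR : ∀ x y, |C x y| ≤ R := by
    intro x y
    have := (hLip' x y y).trans (hdR x y)
    rwa [hdiag, sub_zero] at this
  have hone : IsPotential φ (1 * Real.exp (0 / ε)) 0 0 := by
    simpa using isPotential_one hφ
  have hconst : ∀ c, ∫ _, Real.exp (c / ε) ∂(α : Measure X) =
      Real.exp ((c + ε * Real.log m) / ε) := by
    intro c
    rw [integral_const, ← hm, smul_eq_mul, add_div, mul_div_cancel_left₀ _ hε.ne', Real.exp_add,
      Real.exp_log hm0, mul_comm]
  have hlog1 : -(ε * |Real.log m|) ≤ ε * Real.log m := by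
    have := mul_le_mul_of_nonneg_left (neg_abs_le (Real.log m)) hε.le
    linarith
  have hlog2 : ε * Real.log m ≤ ε * |Real.log m| :=
    mul_le_mul_of_nonneg_left (le_abs_self (Real.log m)) hε.le
  obtain ⟨f, hf⟩ := exists_fixedPoint_of_nonexpansive A hA hB0 hTlip (by
    intro f θ h0 h1 hfθ x
    have hfx : ∀ x, f x = θ * T (expIntegral C ε α f x) := fun x => by
      conv_lhs => rw [hfθ]
      rfl
    have hosc : ∀ x y, f x - f y ≤ R := by
      intro x y
      have h2 := (le_abs_self _).trans ((hTlip f x y).trans (hdR x y))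
      rw [hfx x, hfx y, ← mul_sub]
      calc θ * (T (expIntegral C ε α f x) - T (expIntegral C ε α f y)) ≤ θ * R := by gcongr
        _ ≤ R := mul_le_of_le_one_left hR0 h1
    have hs := expIntegral_pos (ε := ε) hα hC f.continuous x
    rw [abs_le]
    constructor
    -- `T` is nonincreasing with `T 1 = 0`. Were `f x` below `-B`, the integral would be at most
    -- `1`, hence `T ≥ 0` and `f x = θ T ≥ 0`. The upper bound is symmetric.
    · by_contra! hlt
      have hs1 : expIntegral C ε α f x ≤ 1 := by
        calc expIntegral C ε α f x ≤ ∫ _, Real.exp ((f x + 2 * R) / ε) ∂(α : Measure X) := by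
              refine integral_mono ((bddMeasurable_expIntegrand hC f.continuous x).integrable _)
                (integrable_const _) fun y => ?_
              refine Real.exp_le_exp.2 (div_le_div_of_nonneg_right ?_ hε.le)
              linarith [hosc y x, (abs_le.1 (hCR x y)).1]
          _ ≤ 1 := by
              rw [hconst, Real.exp_le_one_iff]
              exact div_nonpos_of_nonpos_of_nonneg (by linarith) hε.le
      have h3 : 0 - T (expIntegral C ε α f x) ≤ 0 :=
        hone.sub_le hε one_pos hs le_rfl (hT _ hs) (by simpa using hs1)
      have h4 : 0 ≤ θ * T (expIntegral C ε α f x) := mul_nonneg h0 (by linarith)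
      rw [← hfx] at h4
      linarith
    · by_contra! hlt
      have hs1 : 1 ≤ expIntegral C ε α f x := by
        calc 1 ≤ ∫ _, Real.exp ((f x - 2 * R) / ε) ∂(α : Measure X) := by
              rw [hconst, Real.one_le_exp_iff]
              exact div_nonneg (by linarith) hε.le
          _ ≤ expIntegral C ε α f x := by
              refine integral_mono (integrable_const _)
                ((bddMeasurable_expIntegrand hC f.continuous x).integrable _) fun y => ?_
              refine Real.exp_le_exp.2 (div_le_div_of_nonneg_right ?_ hε.le)
              linarith [hosc x y, (abs_le.1 (hCR x y)).2]
      have h3 : T (expIntegral C ε α f x) - 0 ≤ 0 :=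
        (hT _ hs).sub_le hε hs one_pos le_rfl hone (by simpa using hs1)
      have h4 : θ * T (expIntegral C ε α f x) ≤ 0 :=
        mul_nonpos_of_nonneg_of_nonpos h0 (by linarith)
      rw [← hfx] at h4
      linarith)
  have hfT : ∀ x, T (expIntegral C ε α f x) = f x := fun x => by rw [← hAx, hf]
  have hpot : ∀ x, IsPotential φ (expIntegral C ε α f x * Real.exp (f x / ε)) (f x)
      (Ψ (expIntegral C ε α f x)) := fun x => by
    have := hT _ (expIntegral_pos (ε := ε) hα hC f.continuous x)
    rwa [hfT] at this
  have hfb : BddMeasurable f := .of_continuous f.continuous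
  have hpb : BddMeasurable fun x => expIntegral C ε α f x * Real.exp (f x / ε) := by
    refine BddMeasurable.mul ?_ (hfb.div_const ε).exp
    exact (((hfb.comp measurable_snd).sub (.of_continuous hC)).div_const ε).exp.integral_right _
  refine ⟨f, fun x => Ψ (expIntegral C ε α f x), f.continuous, ⟨?_, ?_⟩, hpot⟩
  -- `Ψ` is an arbitrary choice function; measurability comes from Fenchel equality, which expresses
  -- it through `φ`, `f` and the marginal density.
  · simp only [(hpot _).eq_toReal]
    exact ((hφ.lowerSemicontinuous.measurable.comp hpb.1.real_toNNReal).ennreal_toReal).add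
      (hfb.mul hpb).1
  · obtain ⟨-, M₂, hM₂⟩ := hfb.mul hpb
    obtain ⟨-, M₁, hM₁⟩ := hfb
    refine ⟨max M₁ M₂, fun x => abs_le.2 ⟨?_, ?_⟩⟩
    · linarith [(hpot x).nonneg, (abs_le.1 (hM₂ x)).1, le_max_right M₁ M₂]
    · linarith [(hpot x).le hφ, (abs_le.1 (hM₁ x)).2, le_max_left M₁ M₂]

end SymmetricPotential

/-! ### The energy of a positive kernel -/

section Energy

variable {X : Type*} [MeasurableSpace X] {k : X → X → ℝ}

/-- The mutual energy `∫∫ k(x,y) dμ(x) dν(y)`. -/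
def energy (k : X → X → ℝ) (μ ν : Measure X) : ℝ := ∫ y, ∫ x, k x y ∂μ ∂ν

variable {μ ν ρ : Measure X} [IsFiniteMeasure μ] [IsFiniteMeasure ν] [IsFiniteMeasure ρ]

theorem bddMeasurable_slice (hk : BddMeasurable fun z : X × X => k z.1 z.2) (y : X) :
    BddMeasurable fun x => k x y := hk.comp (h := fun x => (x, y)) measurable_prodMk_right

theorem bddMeasurable_integral_slice (hk : BddMeasurable fun z : X × X => k z.1 z.2)
    (μ : Measure X) [IsFiniteMeasure μ] : BddMeasurable fun y => ∫ x, k x y ∂μ :=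
  (hk.comp (h := fun z : X × X => (z.2, z.1)) measurable_swap).integral_right μ

theorem energy_comm (hk : BddMeasurable fun z : X × X => k z.1 z.2)
    (hsymm : ∀ x y, k x y = k y x) : energy k μ ν = energy k ν μ := by
  unfold energy
  rw [integral_integral_swap]
  · simp only [hsymm]
  · exact (hk.comp (h := fun z : X × X => (z.2, z.1)) measurable_swap).integrable _

theorem energy_add_right (hk : BddMeasurable fun z : X × X => k z.1 z.2) :
    energy k ρ (μ + ν) = energy k ρ μ + energy k ρ ν :=
  integral_add_measure ((bddMeasurable_integral_slice hk ρ).integrable μ)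
    ((bddMeasurable_integral_slice hk ρ).integrable ν)

theorem energy_add_left (hk : BddMeasurable fun z : X × X => k z.1 z.2)
    (hsymm : ∀ x y, k x y = k y x) :
    energy k (μ + ν) ρ = energy k μ ρ + energy k ν ρ := by
  rw [energy_comm hk hsymm, energy_add_right hk, energy_comm hk hsymm (μ := ρ) (ν := μ),
    energy_comm hk hsymm (μ := ρ) (ν := ν)]

omit [IsFiniteMeasure μ] [IsFiniteMeasure ρ] in
theorem energy_smul_right (c : ℝ≥0) : energy k ρ (c • μ) = c * energy k ρ μ :=
  integral_smul_nnreal_measure _ c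

omit [IsFiniteMeasure μ] [IsFiniteMeasure ρ] in
theorem energy_smul_left (c : ℝ≥0) : energy k (c • μ) ρ = c * energy k μ ρ := by
  simp only [energy, integral_smul_nnreal_measure, NNReal.smul_def, smul_eq_mul,
    integral_const_mul]

theorem vectorMeasure_integral_sub {h : X → ℝ} (hh : BddMeasurable h) :
    (∫ᵛ x, h x ∂•(μ.toSignedMeasure - ν.toSignedMeasure)) = ∫ x, h x ∂μ - ∫ x, h x ∂ν := by
  have hflip : ContinuousLinearMap.lsmul ℝ ℝ (E := ℝ) =
      (ContinuousLinearMap.lsmul ℝ ℝ (E := ℝ)).flip := by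
    ext; simp
  rw [VectorMeasure.integral_sub_vectorMeasure, hflip, VectorMeasure.integral_toSignedMeasure,
    VectorMeasure.integral_toSignedMeasure]
  · rw [VectorMeasure.Integrable, Measure.variation_toSignedMeasure]
    exact hh.integrable μ
  · rw [VectorMeasure.Integrable, Measure.variation_toSignedMeasure]
    exact hh.integrable ν

theorem energy_sub_nonneg (hk : BddMeasurable fun z : X × X => k z.1 z.2)
    (hsymm : ∀ x y, k x y = k y x) (hpos : IsPositiveKernel k)
    (μ ν : Measure X) [IsFiniteMeasure μ] [IsFiniteMeasure ν] :
    0 ≤ energy k μ μ - 2 * energy k μ ν + energy k ν ν := by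
  have h := hpos (μ.toSignedMeasure - ν.toSignedMeasure)
  have e : (fun y => ∫ᵛ x, k x y ∂•(μ.toSignedMeasure - ν.toSignedMeasure)) =
      fun y => ∫ x, k x y ∂μ - ∫ x, k x y ∂ν :=
    funext fun y => vectorMeasure_integral_sub (bddMeasurable_slice hk y)
  have hμ := bddMeasurable_integral_slice hk μ
  have hν := bddMeasurable_integral_slice hk ν
  rw [e, vectorMeasure_integral_sub (hμ.sub hν), integral_sub (hμ.integrable _) (hν.integrable _),
    integral_sub (hμ.integrable _) (hν.integrable _)] at h
  change 0 ≤ energy k μ μ - energy k ν μ - (energy k μ ν - energy k ν ν) at h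
  rw [energy_comm hk hsymm (μ := ν) (ν := μ)] at h
  linarith

theorem energy_convex (hk : BddMeasurable fun z : X × X => k z.1 z.2)
    (hsymm : ∀ x y, k x y = k y x) (hpos : IsPositiveKernel k)
    (μ ν : Measure X) [IsFiniteMeasure μ] [IsFiniteMeasure ν] {s t : ℝ≥0} (hst : s + t = 1) :
    energy k (s • μ + t • ν) (s • μ + t • ν) ≤ s * energy k μ μ + t * energy k ν ν := by
  rw [energy_add_left hk hsymm, energy_add_right hk, energy_add_right hk]
  simp only [energy_smul_left, energy_smul_right]
  rw [energy_comm hk hsymm (μ := ν) (ν := μ)]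
  have h := mul_nonneg (mul_nonneg s.2 t.2) (energy_sub_nonneg hk hsymm hpos μ ν)
  have ht : (t : ℝ) = 1 - s := by rw [eq_sub_iff_add_eq', ← NNReal.coe_add, hst, NNReal.coe_one]
  simp only [NNReal.val_eq_coe] at h
  rw [ht] at h ⊢
  linarith

/-- A null vector of a positive form lies in its radical. Adding `t δ_y` to `μ` changes the squared
norm of `μ - ν` from `0` to `2 t d + t² k(y,y) ≥ 0`; divide by `t` and let `t → 0`. As `t ≥ 0` this
gives one inequality, and exchanging `μ` and `ν` gives the other. -/
theorem integral_slice_le_of_energy_sub_eq_zero (hk : BddMeasurable fun z : X × X => k z.1 z.2)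
    (hsymm : ∀ x y, k x y = k y x) (hpos : IsPositiveKernel k)
    (h : energy k μ μ - 2 * energy k μ ν + energy k ν ν = 0) (y : X) :
    ∫ x, k x y ∂ν ≤ ∫ x, k x y ∂μ := by
  have hd : ∀ (μ : Measure X) [IsFiniteMeasure μ],
      energy k μ (Measure.dirac y) = ∫ x, k x y ∂μ := fun μ _ =>
    integral_dirac' _ _ (bddMeasurable_integral_slice hk μ).1.stronglyMeasurable
  set d := ∫ x, k x y ∂μ - ∫ x, k x y ∂ν with hdef
  have key : ∀ t : ℝ≥0, 0 < t →
      0 ≤ 2 * d + t * energy k (Measure.dirac y) (Measure.dirac y) := by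
    intro t ht
    have h1 := energy_sub_nonneg hk hsymm hpos (μ + t • Measure.dirac y) ν
    rw [energy_add_left hk hsymm, energy_add_right hk, energy_add_right hk,
      energy_add_left hk hsymm] at h1
    simp only [energy_smul_left, energy_smul_right] at h1
    rw [energy_comm hk hsymm (μ := Measure.dirac y) (ν := μ),
      energy_comm hk hsymm (μ := Measure.dirac y) (ν := ν), hd μ, hd ν] at h1
    have h2 : 0 ≤ (t : ℝ) * (2 * d + t * energy k (Measure.dirac y) (Measure.dirac y)) := by
      rw [hdef]
      linarith
    exact nonneg_of_mul_nonneg_right h2 (by exact_mod_cast ht)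
  have h2 : 0 ≤ 2 * d := by
    have htend : Tendsto (fun t : ℝ =>
        2 * d + t * energy k (Measure.dirac y) (Measure.dirac y)) (𝓝[>] 0) (𝓝 (2 * d)) := by
      refine Tendsto.mono_left ?_ nhdsWithin_le_nhds
      have : Continuous fun t : ℝ =>
        2 * d + t * energy k (Measure.dirac y) (Measure.dirac y) := by fun_prop
      simpa using this.tendsto 0
    refine ge_of_tendsto htend ?_
    filter_upwards [self_mem_nhdsWithin] with t ht
    exact key ⟨t, le_of_lt ht⟩ ht
  linarith

end Energy

/-- Both measures integrate every kernel slice equally, hence every continuous function by density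
of the span. -/
theorem eq_of_energy_sub_eq_zero {X : Type*} [MetricSpace X] [CompactSpace X] [MeasurableSpace X]
    [BorelSpace X] {k : X → X → ℝ} {μ ν : Measure X} [IsFiniteMeasure μ] [IsFiniteMeasure ν]
    (hk : BddMeasurable fun z : X × X => k z.1 z.2)
    (hsymm : ∀ x y, k x y = k y x) (hpos : IsPositiveKernel k) (huniv : IsUniversalKernel k)
    (h : energy k μ μ - 2 * energy k μ ν + energy k ν ν = 0) : μ = ν := by
  have h' : energy k ν ν - 2 * energy k ν μ + energy k μ μ = 0 := by
    rw [energy_comm hk hsymm (μ := ν) (ν := μ)]; linarith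
  have hslice : ∀ y, ∫ x, k x y ∂μ = ∫ x, k x y ∂ν := fun y => le_antisymm
    (integral_slice_le_of_energy_sub_eq_zero hk hsymm hpos h' y)
    (integral_slice_le_of_energy_sub_eq_zero hk hsymm hpos h y)
  have hint : ∀ (f : C(X, ℝ)) (ρ : Measure X) [IsFiniteMeasure ρ], Integrable f ρ := fun f ρ _ =>
    (BddMeasurable.of_continuous f.continuous).integrable ρ
  have hcont : ∀ (ρ : Measure X) [IsFiniteMeasure ρ], Continuous fun f : C(X, ℝ) => ∫ x, f x ∂ρ := by
    intro ρ _
    refine (LipschitzWith.of_dist_le_mul (K := (ρ univ).toNNReal) fun f g => ?_).continuous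
    rw [dist_eq_norm, ← integral_sub (hint f ρ) (hint g ρ), mul_comm]
    exact norm_integral_le_of_norm_le_const (ae_of_all _ fun x =>
      (dist_eq_norm (f x) (g x)).symm.trans_le (ContinuousMap.dist_apply_le_dist x))
  have hall : ∀ f : C(X, ℝ), ∫ x, f x ∂μ = ∫ x, f x ∂ν := by
    intro f
    refine Dense.induction huniv (P := fun f : C(X, ℝ) => ∫ x, f x ∂μ = ∫ x, f x ∂ν)
      (fun f hf => ?_) (isClosed_eq (hcont μ) (hcont ν)) f
    rw [SetLike.mem_coe] at hf
    induction hf using Submodule.span_induction with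
    | mem f hf =>
      obtain ⟨y, hy⟩ := hf
      simp only [hy, hslice]
    | zero => simp
    | add f g _ _ hf hg =>
      simp only [ContinuousMap.add_apply]
      rw [integral_add (hint f μ) (hint g μ), integral_add (hint f ν) (hint g ν), hf, hg]
    | smul c f _ hf =>
      simp only [ContinuousMap.smul_apply, integral_smul, hf]
  exact ext_of_forall_integral_eq_of_IsFiniteMeasure fun f => hall f.toContinuousMap

/-! ### The dual value as an energy of the measures `exp(f/ε) α` -/

section ExpMeasure

variable {X : Type*} [MeasurableSpace X] {C : X → X → ℝ} {ε : ℝ} {α β : FiniteMeasure X}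
  {f g ψ η : X → ℝ}

/-- The measure `exp (f / ε) α`. -/
def expMeasure (ε : ℝ) (α : FiniteMeasure X) (f : X → ℝ) : Measure X :=
  (α : Measure X).withDensity fun x => ENNReal.ofReal (Real.exp (f x / ε))

theorem isFiniteMeasure_expMeasure (hf : BddMeasurable f) :
    IsFiniteMeasure (expMeasure ε α f) :=
  isFiniteMeasure_withDensity_ofReal ((hf.div_const ε).exp.integrable (α : Measure X)).2

theorem integral_expMeasure (hf : BddMeasurable f) (h : X → ℝ) :
    ∫ x, h x ∂(expMeasure ε α f) = ∫ x, Real.exp (f x / ε) * h x ∂(α : Measure X) := by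
  rw [expMeasure, integral_withDensity_eq_integral_toReal_smul
    (hf.div_const ε).exp.1.ennreal_ofReal (ae_of_all _ fun _ => ENNReal.ofReal_lt_top)]
  simp only [ENNReal.toReal_ofReal (Real.exp_pos _).le, smul_eq_mul]

theorem withDensity_expMeasure (hf : BddMeasurable f) :
    (expMeasure ε α f).withDensity (fun x => ENNReal.ofReal (Real.exp (-(f x / ε)))) =
      (α : Measure X) := by
  rw [expMeasure, ← withDensity_mul _ (hf.div_const ε).exp.1.ennreal_ofReal
    (hf.div_const ε).neg.exp.1.ennreal_ofReal]
  have : ((fun x => ENNReal.ofReal (Real.exp (f x / ε))) *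
      fun x => ENNReal.ofReal (Real.exp (-(f x / ε)))) = 1 := by
    funext x
    rw [Pi.mul_apply, ← ENNReal.ofReal_mul (Real.exp_pos _).le, ← Real.exp_add]
    simp
  rw [this, withDensity_one]

theorem expMeasure_injective (hf : BddMeasurable f)
    (h : expMeasure ε α f = expMeasure ε β f) : α = β := by
  refine Subtype.ext ?_
  change (α : Measure X) = (β : Measure X)
  rw [← withDensity_expMeasure (ε := ε) (α := α) hf, h, withDensity_expMeasure hf]

theorem gibbsDensity_eq {X : Type*} (C : X → X → ℝ) (ε : ℝ) (f g : X → ℝ) (x y : X) :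
    gibbsDensity C ε f g (x, y) =
      Real.exp (g y / ε) * (Real.exp (f x / ε) * gibbsKernel C ε x y) := by
  rw [gibbsDensity, gibbsKernel, ← Real.exp_add, ← Real.exp_add]
  congr 1
  ring

theorem integral_gibbsDensity (hC : BddMeasurable fun z : X × X => C z.1 z.2)
    (hf : BddMeasurable f) (hg : BddMeasurable g) :
    ∫ z, gibbsDensity C ε f g z ∂((α : Measure X).prod (β : Measure X)) =
      energy (gibbsKernel C ε) (expMeasure ε α f) (expMeasure ε β g) := by
  rw [integral_prod_symm _ ((bddMeasurable_gibbsDensity hC hf hg).integrable _), energy]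
  simp only [integral_expMeasure hf, integral_expMeasure hg, gibbsDensity_eq, integral_const_mul]

theorem dualValue_eq (hC : BddMeasurable fun z : X × X => C z.1 z.2)
    (hf : BddMeasurable f) (hg : BddMeasurable g) :
    dualValue C ε α β f g ψ η = ∫ x, ψ x ∂(α : Measure X) + ∫ y, η y ∂(β : Measure X) +
      ε * (α.mass * β.mass -
        energy (gibbsKernel C ε) (expMeasure ε α f) (expMeasure ε β g)) := by
  rw [dualValue, integral_sub (integrable_const _)
    ((bddMeasurable_gibbsDensity hC hf hg).integrable _), integral_gibbsDensity hC hf hg]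
  simp [measureReal_prod_prod, ← univ_prod_univ]
  left
  rfl

end ExpMeasure

theorem coe_sub_half_mul (x : EReal) (a b c : ℝ) :
    x - ((1 / 2 : ℝ) : EReal) * (a : EReal) - ((1 / 2 : ℝ) : EReal) * (b : EReal) + (c : EReal) =
      x + ((c - a / 2 - b / 2 : ℝ) : EReal) := by
  rw [← EReal.coe_mul, ← EReal.coe_mul]
  induction x with
  | bot => simp
  | top => simp only [EReal.top_sub_coe, EReal.top_add_coe]
  | coe x =>
    norm_cast
    ring

/-! ### Lower bound of the Sinkhorn divergence by an energy -/

section SelfPotential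

variable {X : Type*} [MeasurableSpace X] {C : X → X → ℝ} {ε : ℝ} {φ : ℝ≥0 → ℝ≥0∞}

/-- Optimal symmetric potentials for the problem `OT_ε(α, α)`. -/
structure IsSelfPotential (C : X → X → ℝ) (φ : ℝ≥0 → ℝ≥0∞) (ε : ℝ) (α : FiniteMeasure X)
    (f ψ : X → ℝ) : Prop where
  bdd_left : BddMeasurable f
  bdd_right : BddMeasurable ψ
  le_map : ∀ (x : X) (q : ℝ≥0), ENNReal.ofReal (ψ x - f x * q) ≤ φ q
  otCost_eq : otCost C φ ε α α = ((dualValue C ε α α f f ψ ψ : ℝ) : EReal)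
  isPotential : α ≠ 0 →
    ∀ x, IsPotential φ (expIntegral C ε α f x * Real.exp (f x / ε)) (f x) (ψ x)

variable {α β : FiniteMeasure X} {f g ψ η : X → ℝ}

theorem sinkhornDiv_eq (hα : IsSelfPotential C φ ε α f ψ) (hβ : IsSelfPotential C φ ε β g η) :
    sinkhornDiv C φ ε α β = otCost C φ ε α β +
      ((ε / 2 * ((α.mass : ℝ) - β.mass) ^ 2 - dualValue C ε α α f f ψ ψ / 2 -
        dualValue C ε β β g g η η / 2 : ℝ) : EReal) := by
  rw [sinkhornDiv, hα.otCost_eq, hβ.otCost_eq, coe_sub_half_mul]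

/-- The self-potentials form an admissible pair for `OT_ε(α,β)`. The integrals of `ψ` and `η` cancel
against the halves of the self-costs, and `(ε/2)(m(α) - m(β))²` cancels the mass products exactly.
-/
theorem energy_le_sinkhornDiv (hε : 0 < ε) (hC : BddMeasurable fun z : X × X => C z.1 z.2)
    (hα : IsSelfPotential C φ ε α f ψ) (hβ : IsSelfPotential C φ ε β g η) :
    ((ε / 2 * (energy (gibbsKernel C ε) (expMeasure ε α f) (expMeasure ε α f) -
      2 * energy (gibbsKernel C ε) (expMeasure ε α f) (expMeasure ε β g) +
      energy (gibbsKernel C ε) (expMeasure ε β g) (expMeasure ε β g)) : ℝ) : EReal) ≤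
      sinkhornDiv C φ ε α β := by
  rw [sinkhornDiv_eq hα hβ]
  refine le_trans (le_of_eq ?_) (add_le_add_left (dualValue_le_otCost hε hC hα.bdd_left
    hβ.bdd_left hα.bdd_right hβ.bdd_right (ae_of_all _ hα.le_map) (ae_of_all _ hβ.le_map)) _)
  rw [← EReal.coe_add, dualValue_eq hC hα.bdd_left hβ.bdd_left,
    dualValue_eq hC hα.bdd_left hα.bdd_left, dualValue_eq hC hβ.bdd_left hβ.bdd_left]
  congr 1
  ring

theorem sinkhornDiv_self (hα : IsSelfPotential C φ ε α f ψ) : sinkhornDiv C φ ε α α = 0 := by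
  rw [sinkhornDiv_eq hα hα, hα.otCost_eq, ← EReal.coe_add]
  norm_cast
  ring

theorem bddMeasurable_gibbsKernel (hC : BddMeasurable fun z : X × X => C z.1 z.2) :
    BddMeasurable fun z : X × X => gibbsKernel C ε z.1 z.2 :=
  (hC.neg.div_const ε).exp

theorem sinkhornDiv_nonneg (hε : 0 < ε) (hC : BddMeasurable fun z : X × X => C z.1 z.2)
    (hsymm : ∀ x y, C x y = C y x) (hpos : IsPositiveKernel (gibbsKernel C ε))
    (hα : IsSelfPotential C φ ε α f ψ) (hβ : IsSelfPotential C φ ε β g η) :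
    0 ≤ sinkhornDiv C φ ε α β := by
  refine le_trans ?_ (energy_le_sinkhornDiv hε hC hα hβ)
  have := isFiniteMeasure_expMeasure (ε := ε) (α := α) hα.bdd_left
  have := isFiniteMeasure_expMeasure (ε := ε) (α := β) hβ.bdd_left
  have h := energy_sub_nonneg (bddMeasurable_gibbsKernel hC)
    (fun x y => by rw [gibbsKernel, gibbsKernel, hsymm]) hpos (expMeasure ε α f) (expMeasure ε β g)
  exact_mod_cast mul_nonneg (half_pos hε).le h

end SelfPotential

/-! ### Self-potentials and definiteness -/

section Sinkhorn

variable {X : Type*} [MetricSpace X] [CompactSpace X] [MeasurableSpace X] [BorelSpace X]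
  {C : X → X → ℝ} {γ ε : ℝ} {φ : ℝ≥0 → ℝ≥0∞}

theorem exists_isSelfPotential (hφ : IsEntropyFunction φ) (hε : 0 < ε)
    (hsymm : ∀ x y, C x y = C y x) (hdiag : ∀ x, C x x = 0)
    (hLip : ∀ x y z, |C x z - C y z| ≤ γ * dist x y) (α : FiniteMeasure X) :
    ∃ f ψ, IsSelfPotential C φ ε α f ψ := by
  have hC : BddMeasurable fun z : X × X => C z.1 z.2 :=
    .of_continuous (continuous_cost hsymm hLip)
  by_cases hα : α = 0
  -- For `α = 0` the scalar equation has `s = 0` and may have no solution, but any dual-feasible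
  -- pair is optimal; zero will do.
  · have h0 := BddMeasurable.const (Y := X) 0
    have hle : ∀ (x : X) (q : ℝ≥0), ENNReal.ofReal ((0 : ℝ) - 0 * q) ≤ φ q := by simp
    refine ⟨fun _ => 0, fun _ => 0, h0, h0, hle, le_antisymm ?_ ?_, fun h => absurd hα h⟩
    · subst hα
      exact otCost_le_dualValue hε hC h0 h0 h0 h0 (by simp) (by simp)
    · exact dualValue_le_otCost hε hC h0 h0 h0 h0 (ae_of_all _ hle) (ae_of_all _ hle)
  · obtain ⟨f, ψ, hf, hψ, hpot⟩ := exists_symmetric_potential hφ hε hsymm hdiag hLip hα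
    have hfb := BddMeasurable.of_continuous hf
    have e : ∀ x, ∫ y, gibbsDensity C ε f f (x, y) ∂(α : Measure X) =
        expIntegral C ε α f x * Real.exp (f x / ε) := by
      intro x
      rw [expIntegral, ← integral_mul_const]
      congr 1 with y
      rw [gibbsDensity, ← Real.exp_add]
      congr 1
      ring
    have e' : ∀ y, ∫ x, gibbsDensity C ε f f (x, y) ∂(α : Measure X) =
        expIntegral C ε α f y * Real.exp (f y / ε) := by
      intro y
      rw [← e]
      congr 1 with x
      simp only [gibbsDensity, hsymm x y, add_comm]
    refine ⟨f, ψ, hfb, hψ, fun x => (hpot x).le_map, le_antisymm ?_ ?_, fun _ => hpot⟩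
    · exact otCost_le_dualValue hε hC hfb hfb hψ hψ (ae_of_all _ fun x => by rw [e]; exact hpot x)
        (ae_of_all _ fun x => by rw [e']; exact hpot x)
    · exact dualValue_le_otCost hε hC hfb hfb hψ hψ (ae_of_all _ fun x => (hpot x).le_map)
        (ae_of_all _ fun x => (hpot x).le_map)

variable {α β : FiniteMeasure X} {f g ψ η : X → ℝ}

theorem eq_of_sinkhornDiv_eq_zero (hε : 0 < ε) (hC : BddMeasurable fun z : X × X => C z.1 z.2)
    (hsymm : ∀ x y, C x y = C y x) (hpos : IsPositiveKernel (gibbsKernel C ε))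
    (huniv : IsUniversalKernel (gibbsKernel C ε))
    (hα : IsSelfPotential C φ ε α f ψ) (hβ : IsSelfPotential C φ ε β g η)
    (h : sinkhornDiv C φ ε α β = 0) : α = β := by
  have := isFiniteMeasure_expMeasure (ε := ε) (α := α) hα.bdd_left
  have := isFiniteMeasure_expMeasure (ε := ε) (α := β) hβ.bdd_left
  have hk := bddMeasurable_gibbsKernel (ε := ε) hC
  have hks : ∀ x y, gibbsKernel C ε x y = gibbsKernel C ε y x :=
    fun x y => by rw [gibbsKernel, gibbsKernel, hsymm]
  have h1 := energy_sub_nonneg hk hks hpos (expMeasure ε α f) (expMeasure ε β g)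
  have h2 := energy_le_sinkhornDiv hε hC hα hβ
  rw [h] at h2
  have h3 := nonpos_of_mul_nonpos_right (show ε / 2 * _ ≤ 0 by exact_mod_cast h2) (half_pos hε)
  have huv := eq_of_energy_sub_eq_zero hk hks hpos huniv (le_antisymm h3 h1)
  have hz : ∀ (α : FiniteMeasure X) (f : X → ℝ), BddMeasurable f → expMeasure ε α f = 0 →
      α = 0 := fun α f hf h0 => expMeasure_injective hf (h0.trans (by simp [expMeasure]))
  by_cases hα0 : α = 0
  · rw [hα0, hz β g hβ.bdd_left (by rw [← huv, hα0]; simp [expMeasure])]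
  by_cases hβ0 : β = 0
  · exact absurd (hz α f hα.bdd_left (by rw [huv, hβ0]; simp [expMeasure])) hα0
  have hexp : ∀ (α : FiniteMeasure X) (f : X → ℝ), BddMeasurable f → ∀ x,
      expIntegral C ε α f x = ∫ y, gibbsKernel C ε x y ∂(expMeasure ε α f) := by
    intro α f hf x
    rw [integral_expMeasure hf, expIntegral]
    congr 1 with y
    rw [gibbsKernel, ← Real.exp_add]
    congr 1
    ring
  have hfg : f = g := by
    funext x
    have e1 := hα.isPotential hα0 x
    have e2 := hβ.isPotential hβ0 x
    have epos : 0 < expIntegral C ε α f x :=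
      have : NeZero (α : Measure X) := ⟨fun h => hα0 (Subtype.ext h)⟩
      integral_exp_pos (((hα.bdd_left.sub (hC.comp
        (h := fun y => (x, y)) measurable_prodMk_left)).div_const ε).exp.integrable _)
    -- `expIntegral` depends only on the measure `exp(f/ε) α`, so `f x` and `g x` solve the same
    -- scalar equation.
    have e3 : expIntegral C ε β g x = expIntegral C ε α f x := by
      rw [hexp α f hα.bdd_left, hexp β g hβ.bdd_left, huv]
    rw [e3] at e2
    exact e1.unique hε epos e2
  subst hfg
  exact expMeasure_injective hα.bdd_left huv

end Sinkhorn

/-! ### Convexity in each argument -/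

section Convexity

theorem exists_withDensity_add {Y : Type*} [MeasurableSpace Y] (μ ν : Measure Y)
    [IsFiniteMeasure μ] [IsFiniteMeasure ν] :
    ∃ l : Y → ℝ≥0, Measurable l ∧ (∀ y, l y ≤ 1) ∧
      μ = (μ + ν).withDensity (fun y => l y) ∧
      ν = (μ + ν).withDensity (fun y => (1 - l y : ℝ≥0)) := by
  have hle : μ ≤ μ + ν := Measure.le_add_right le_rfl
  -- The truncation at `1` changes the density only on a null set and makes `l ≤ 1` hold everywhere.
  set l : Y → ℝ≥0 := fun y => min (μ.rnDeriv (μ + ν) y).toNNReal 1 with hl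
  have hlm : Measurable l := (Measure.measurable_rnDeriv _ _).ennreal_toNNReal.min measurable_const
  have h1 : μ = (μ + ν).withDensity (fun y => l y) := by
    conv_lhs => rw [← Measure.withDensity_rnDeriv_eq μ (μ + ν)
      (Measure.absolutelyContinuous_of_le hle)]
    refine withDensity_congr_ae ?_
    filter_upwards [Measure.rnDeriv_le_one_of_le hle] with y hy
    have hne : μ.rnDeriv (μ + ν) y ≠ ∞ := ne_top_of_le_ne_top ENNReal.one_ne_top hy
    have h2 : (μ.rnDeriv (μ + ν) y).toNNReal ≤ 1 := by
      simpa using ENNReal.toNNReal_mono ENNReal.one_ne_top hy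
    simp only [hl, min_eq_left h2, ENNReal.coe_toNNReal hne]
  have hl1 : ∀ y, l y ≤ 1 := fun y => min_le_right _ _
  refine ⟨l, hlm, hl1, h1, ?_⟩
  have h3 : μ + ν = μ + (μ + ν).withDensity (fun y => (1 - l y : ℝ≥0)) := by
    conv_rhs => enter [1]; rw [h1]
    rw [← withDensity_add_left hlm.coe_nnreal_ennreal]
    conv_lhs => rw [← withDensity_one (μ := μ + ν)]
    congr 1
    funext y
    simp only [Pi.one_apply, Pi.add_apply, ← ENNReal.coe_add, add_tsub_cancel_of_le (hl1 y),
      ENNReal.coe_one]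
  ext S hS
  have h4 := congrArg (fun ρ : Measure Y => ρ S) h3
  simp only [Measure.add_apply μ] at h4
  exact (ENNReal.add_right_inj (measure_ne_top μ S)).1 h4

variable {Y : Type*} [MeasurableSpace Y] {φ : ℝ≥0 → ℝ≥0∞}

/-- The density of the combined `μ` with respect to the combined `ν` is the average of the two
densities with pointwise weights `l` and `1 - l`, where `l` is the share of `s • ν₀` in `ν`.
Convexity of `φ` is then applied pointwise. -/
theorem csiszarDiv_convex (hφ : ConvexOn ℝ≥0 univ φ) (hφm : Measurable φ)
    {μ₀ μ₁ ν₀ ν₁ : Measure Y} [IsFiniteMeasure μ₀] [IsFiniteMeasure μ₁] [IsFiniteMeasure ν₀]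
    [IsFiniteMeasure ν₁] (h₀ : μ₀ ≪ ν₀) (h₁ : μ₁ ≪ ν₁) (s t : ℝ≥0) :
    csiszarDiv φ (s • μ₀ + t • μ₁) (s • ν₀ + t • ν₁) ≤
      s * csiszarDiv φ μ₀ ν₀ + t * csiszarDiv φ μ₁ ν₁ := by
  obtain ⟨l, hlm, hl1, hl₀, hl₁⟩ := exists_withDensity_add (s • ν₀) (t • ν₁)
  set ν := s • ν₀ + t • ν₁ with hν
  have hl'm : Measurable fun y => 1 - l y := measurable_const.sub hlm
  set r₀ : Y → ℝ≥0 := fun y => (μ₀.rnDeriv ν₀ y).toNNReal with hr₀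
  set r₁ : Y → ℝ≥0 := fun y => (μ₁.rnDeriv ν₁ y).toNNReal with hr₁
  have hr₀m : Measurable r₀ := (Measure.measurable_rnDeriv _ _).ennreal_toNNReal
  have hr₁m : Measurable r₁ := (Measure.measurable_rnDeriv _ _).ennreal_toNNReal
  have hden : ∀ {μ ν : Measure Y} [IsFiniteMeasure μ] [IsFiniteMeasure ν], μ ≪ ν →
      μ = ν.withDensity fun y => ((μ.rnDeriv ν y).toNNReal : ℝ≥0∞) := by
    intro μ ν _ _ h
    conv_lhs => rw [← Measure.withDensity_rnDeriv_eq μ ν h]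
    refine withDensity_congr_ae ?_
    filter_upwards [Measure.rnDeriv_lt_top μ ν] with y hy
    rw [ENNReal.coe_toNNReal hy.ne]
  set r : Y → ℝ≥0 := fun y => l y * r₀ y + (1 - l y) * r₁ y with hr
  have hμ : s • μ₀ + t • μ₁ = ν.withDensity fun y => (r y : ℝ≥0∞) := by
    have e : (fun y => (r y : ℝ≥0∞)) =
        ((fun y => (l y : ℝ≥0∞)) * fun y => (r₀ y : ℝ≥0∞)) +
        ((fun y => ((1 - l y : ℝ≥0) : ℝ≥0∞)) * fun y => (r₁ y : ℝ≥0∞)) := by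
      funext y
      simp [hr]
    rw [e, withDensity_add_left (hlm.coe_nnreal_ennreal.mul hr₀m.coe_nnreal_ennreal),
      withDensity_mul _ hlm.coe_nnreal_ennreal hr₀m.coe_nnreal_ennreal,
      withDensity_mul _ hl'm.coe_nnreal_ennreal hr₁m.coe_nnreal_ennreal, ← hl₀, ← hl₁]
    conv_lhs => rw [hden h₀, hden h₁]
    simp only [ENNReal.smul_def, withDensity_smul_measure]
    rfl
  have hrm : Measurable fun y => (r y : ℝ≥0∞) :=
    ((hlm.mul hr₀m).add (hl'm.mul hr₁m)).coe_nnreal_ennreal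
  have hν₀ : ∫⁻ y, (l y : ℝ≥0∞) * φ (r₀ y) ∂ν = s * csiszarDiv φ μ₀ ν₀ := by
    rw [csiszarDiv_of_ac φ h₀, ← smul_eq_mul, ← ENNReal.smul_def, ← lintegral_smul_measure]
    conv_rhs => rw [hl₀]
    exact (lintegral_withDensity_eq_lintegral_mul _ hlm.coe_nnreal_ennreal (hφm.comp hr₀m)).symm
  have hν₁ : ∫⁻ y, ((1 - l y : ℝ≥0) : ℝ≥0∞) * φ (r₁ y) ∂ν = t * csiszarDiv φ μ₁ ν₁ := by
    rw [csiszarDiv_of_ac φ h₁, ← smul_eq_mul, ← ENNReal.smul_def, ← lintegral_smul_measure]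
    conv_rhs => rw [hl₁]
    exact (lintegral_withDensity_eq_lintegral_mul _ hl'm.coe_nnreal_ennreal (hφm.comp hr₁m)).symm
  rw [hμ, csiszarDiv_of_ac φ (withDensity_absolutelyContinuous _ _), ← hν₀, ← hν₁,
    ← lintegral_add_left (f := fun y => (l y : ℝ≥0∞) * φ (r₀ y)) (hlm.coe_nnreal_ennreal.mul (hφm.comp hr₀m))]
  refine lintegral_mono_ae ?_
  filter_upwards [Measure.rnDeriv_withDensity ν hrm] with y hy
  rw [hy, ENNReal.toNNReal_coe]
  have := hφ.2 (mem_univ (r₀ y)) (mem_univ (r₁ y)) (zero_le : 0 ≤ l y)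
    (zero_le : 0 ≤ 1 - l y) (add_tsub_cancel_of_le (hl1 y))
  simpa only [ENNReal.smul_def, smul_eq_mul] using this

theorem convexOn_klEntropy : ConvexOn ℝ≥0 univ klEntropy := by
  refine ⟨convex_univ, fun p _ q _ a b _ _ hab => ?_⟩
  simp only [klEntropy, ENNReal.smul_def, smul_eq_mul]
  rw [← ENNReal.ofReal_coe_nnreal (p := a), ← ENNReal.ofReal_coe_nnreal (p := b),
    ← ENNReal.ofReal_mul a.coe_nonneg, ← ENNReal.ofReal_mul b.coe_nonneg,
    ← ENNReal.ofReal_add (mul_nonneg a.coe_nonneg (klFun_nonneg p.coe_nonneg))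
      (mul_nonneg b.coe_nonneg (klFun_nonneg q.coe_nonneg))]
  refine ENNReal.ofReal_le_ofReal ?_
  have := convexOn_klFun.2 (show (p : ℝ) ∈ Ici 0 from p.coe_nonneg)
    (show (q : ℝ) ∈ Ici 0 from q.coe_nonneg) a.coe_nonneg b.coe_nonneg (by exact_mod_cast hab)
  simpa using this

theorem measurable_klEntropy : Measurable klEntropy :=
  (measurable_klFun.comp measurable_coe_nnreal_real).ennreal_ofReal

variable {X : Type*} [MeasurableSpace X] {C : X → X → ℝ} {ε : ℝ} {α β α₀ α₁ : FiniteMeasure X}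

/-- Only `α` varies: the reference measure `α ⊗ β` of the KL term is linear in `α` for fixed `β`,
but merely bilinear in the pair. -/
theorem objectiveDiv_convex (hε : 0 < ε) (hφ : ConvexOn ℝ≥0 univ φ) (hφm : Measurable φ)
    {π₀ π₁ : FiniteMeasure (X × X)} (h₀ : objectiveDiv φ ε α₀ β π₀ ≠ ∞)
    (h₁ : objectiveDiv φ ε α₁ β π₁ ≠ ∞) {s t : ℝ≥0} (hst : s + t = 1) :
    objectiveDiv φ ε (s • α₀ + t • α₁) β (s • π₀ + t • π₁) ≤
      s * objectiveDiv φ ε α₀ β π₀ + t * objectiveDiv φ ε α₁ β π₁ := by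
  have ac₀ := ac_of_objectiveDiv_ne_top hε h₀
  have ac₁ := ac_of_objectiveDiv_ne_top hε h₁
  have hβ : (β : Measure X) = s • (β : Measure X) + t • (β : Measure X) := by
    rw [← add_smul, hst, one_smul]
  have hfst : ((s • π₀ + t • π₁ : FiniteMeasure (X × X)) : Measure (X × X)).fst =
      s • (π₀ : Measure (X × X)).fst + t • (π₁ : Measure (X × X)).fst := by
    simp only [FiniteMeasure.toMeasure_add, FiniteMeasure.toMeasure_smul, Measure.fst,
      Measure.map_add _ _ measurable_fst, Measure.map_smul]
  have hsnd : ((s • π₀ + t • π₁ : FiniteMeasure (X × X)) : Measure (X × X)).snd =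
      s • (π₀ : Measure (X × X)).snd + t • (π₁ : Measure (X × X)).snd := by
    simp only [FiniteMeasure.toMeasure_add, FiniteMeasure.toMeasure_smul, Measure.snd,
      Measure.map_add _ _ measurable_snd, Measure.map_smul]
  have hprod : ((s • α₀ + t • α₁ : FiniteMeasure X) : Measure X).prod (β : Measure X) =
      s • (α₀ : Measure X).prod (β : Measure X) + t • (α₁ : Measure X).prod (β : Measure X) := by
    simp only [FiniteMeasure.toMeasure_add, FiniteMeasure.toMeasure_smul]
    rw [Measure.add_prod]
    simp only [ENNReal.smul_def, Measure.prod_smul_left]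
  have hac : ((s • π₀ + t • π₁ : FiniteMeasure (X × X)) : Measure (X × X)) ≪
      ((s • α₀ + t • α₁ : FiniteMeasure X) : Measure X).prod (β : Measure X) := by
    rw [hprod]
    exact (ac₀.smul s).add (ac₁.smul t)
  have hkl : klDiv ((s • π₀ + t • π₁ : FiniteMeasure (X × X)) : Measure (X × X))
      (((s • α₀ + t • α₁ : FiniteMeasure X) : Measure X).prod (β : Measure X)) ≤
      s * klDiv (π₀ : Measure (X × X)) ((α₀ : Measure X).prod (β : Measure X)) +
      t * klDiv (π₁ : Measure (X × X)) ((α₁ : Measure X).prod (β : Measure X)) := by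
    rw [klDiv_eq_csiszarDiv hac, klDiv_eq_csiszarDiv ac₀, klDiv_eq_csiszarDiv ac₁, hprod]
    exact csiszarDiv_convex convexOn_klEntropy measurable_klEntropy ac₀ ac₁ s t
  have h1 := csiszarDiv_convex hφ hφm (fst_ac_of_ac_prod ac₀) (fst_ac_of_ac_prod ac₁) s t
  have h2 := csiszarDiv_convex hφ hφm (snd_ac_of_ac_prod ac₀) (snd_ac_of_ac_prod ac₁) s t
  rw [← hβ, ← hsnd] at h2
  rw [← hfst] at h1
  unfold objectiveDiv
  calc _ ≤ (s * csiszarDiv φ (π₀ : Measure (X × X)).fst (α₀ : Measure X) +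
        t * csiszarDiv φ (π₁ : Measure (X × X)).fst (α₁ : Measure X)) +
      (s * csiszarDiv φ (π₀ : Measure (X × X)).snd (β : Measure X) +
        t * csiszarDiv φ (π₁ : Measure (X × X)).snd (β : Measure X)) +
      ENNReal.ofReal ε *
        (s * klDiv (π₀ : Measure (X × X)) ((α₀ : Measure X).prod (β : Measure X)) +
        t * klDiv (π₁ : Measure (X × X)) ((α₁ : Measure X).prod (β : Measure X))) :=
      add_le_add (add_le_add h1 h2) (by gcongr)
    _ = _ := by ring

theorem otCost_convex_left (hε : 0 < ε) (hφ : IsEntropyFunction φ)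
    (hC : BddMeasurable fun z : X × X => C z.1 z.2) {s t : ℝ≥0} (hst : s + t = 1) {c₀ c₁ : ℝ}
    (h₀ : otCost C φ ε α₀ β = (c₀ : EReal)) (h₁ : otCost C φ ε α₁ β = (c₁ : EReal)) :
    otCost C φ ε (s • α₀ + t • α₁) β ≤ ((s * c₀ + t * c₁ : ℝ) : EReal) := by
  have hstR : (s : ℝ) + t = 1 := by exact_mod_cast hst
  have hlt : ∀ (α : FiniteMeasure X) (c b : ℝ), otCost C φ ε α β = (c : EReal) → c < b →
      ∃ π : FiniteMeasure (X × X), objectiveDiv φ ε α β π ≠ ∞ ∧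
        ∫ z, C z.1 z.2 ∂(π : Measure (X × X)) + (objectiveDiv φ ε α β π).toReal < b := by
    intro α c b hc hcb
    have h : otCost C φ ε α β < (b : EReal) := by rw [hc]; exact_mod_cast hcb
    obtain ⟨π, hπ⟩ := iInf_lt_iff.1 h
    have hne : objectiveDiv φ ε α β π ≠ ∞ := by
      intro htop
      rw [otObjective_of_eq_top htop] at hπ
      exact not_top_lt hπ
    rw [otObjective_of_ne_top hne] at hπ
    exact ⟨π, hne, by exact_mod_cast hπ⟩
  refine EReal.le_of_forall_lt_iff_le.1 fun z hz => ?_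
  have hz' : (s : ℝ) * c₀ + t * c₁ < z := by exact_mod_cast hz
  -- The infimum need not be known to be attained, so plans that are optimal up to `δ` are combined.
  set δ := z - (s * c₀ + t * c₁) with hδ
  obtain ⟨π₀, n₀, l₀⟩ := hlt α₀ c₀ (c₀ + δ) h₀ (by linarith)
  obtain ⟨π₁, n₁, l₁⟩ := hlt α₁ c₁ (c₁ + δ) h₁ (by linarith)
  have hobj := objectiveDiv_convex hε hφ.convexOn hφ.lowerSemicontinuous.measurable n₀ n₁ hst
  have hfin : (s : ℝ≥0∞) * objectiveDiv φ ε α₀ β π₀ + t * objectiveDiv φ ε α₁ β π₁ ≠ ∞ := by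
    finiteness
  refine (iInf_le _ (s • π₀ + t • π₁)).trans ?_
  rw [otObjective_of_ne_top (ne_top_of_le_ne_top hfin hobj), EReal.coe_le_coe_iff]
  have h3 := ENNReal.toReal_mono hfin hobj
  rw [ENNReal.toReal_add (by finiteness) (by finiteness), ENNReal.toReal_mul,
    ENNReal.toReal_mul, ENNReal.coe_toReal, ENNReal.coe_toReal] at h3
  have h4 : ∫ z, C z.1 z.2 ∂((s • π₀ + t • π₁ : FiniteMeasure (X × X)) : Measure (X × X)) =
      s * ∫ z, C z.1 z.2 ∂(π₀ : Measure (X × X)) + t * ∫ z, C z.1 z.2 ∂(π₁ : Measure (X × X)) := by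
    rw [FiniteMeasure.toMeasure_add, integral_add_measure (hC.integrable _) (hC.integrable _),
      FiniteMeasure.toMeasure_smul, FiniteMeasure.toMeasure_smul, integral_smul_nnreal_measure,
      integral_smul_nnreal_measure]
    rfl
  rw [h4]
  have m₀ := mul_le_mul_of_nonneg_left l₀.le s.2
  have m₁ := mul_le_mul_of_nonneg_left l₁.le t.2
  simp only [NNReal.val_eq_coe] at m₀ m₁
  have : z = s * (c₀ + δ) + t * (c₁ + δ) := by
    have : (s : ℝ) * (c₀ + δ) + t * (c₁ + δ) = s * c₀ + t * c₁ + (s + t) * δ := by ring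
    rw [this, hstR, hδ]; ring
  linarith

theorem otCost_comm (hC : BddMeasurable fun z : X × X => C z.1 z.2)
    (hsymm : ∀ x y, C x y = C y x) : otCost C φ ε α β = otCost C φ ε β α := by
  have key : ∀ α β : FiniteMeasure X, otCost C φ ε α β ≤ otCost C φ ε β α := by
    intro α β
    refine le_iInf fun π => (iInf_le _ (π.map Prod.swap)).trans ?_
    have hmap : ((π.map Prod.swap : FiniteMeasure (X × X)) : Measure (X × X)) =
        (π : Measure (X × X)).map Prod.swap := FiniteMeasure.toMeasure_map _ _
    have hint : ∫ z, C z.1 z.2 ∂((π : Measure (X × X)).map Prod.swap) =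
        ∫ z, C z.1 z.2 ∂(π : Measure (X × X)) := by
      rw [integral_map measurable_swap.aemeasurable hC.1.aestronglyMeasurable]
      simp only [Prod.fst_swap, Prod.snd_swap, hsymm]
    have hkl : klDiv ((π : Measure (X × X)).map Prod.swap)
        ((α : Measure X).prod (β : Measure X)) ≤
        -- The data-processing inequality suffices, since the argument is run in both directions.
        klDiv (π : Measure (X × X)) ((β : Measure X).prod (α : Measure X)) := by
      rw [← Measure.prod_swap]
      exact klDiv_map_le _ _ measurable_swap
    rw [otObjective, otObjective, hmap, hint, Measure.fst_map_swap, Measure.snd_map_swap,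
      add_comm (csiszarDiv φ (π : Measure (X × X)).snd _)]
    exact add_le_add le_rfl (EReal.coe_ennreal_le_coe_ennreal_iff.2 (by gcongr))
  exact le_antisymm (key α β) (key β α)

theorem energy_mono {k : X → X → ℝ} (hk : BddMeasurable fun z : X × X => k z.1 z.2)
    (hk0 : ∀ x y, 0 ≤ k x y) {μ ν : Measure X} [IsFiniteMeasure ν] (h : μ ≤ ν) :
    energy k μ μ ≤ energy k ν ν := by
  have : IsFiniteMeasure μ := isFiniteMeasure_of_le ν h
  calc energy k μ μ ≤ energy k ν μ := by
        refine integral_mono ((bddMeasurable_integral_slice hk μ).integrable μ)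
          ((bddMeasurable_integral_slice hk ν).integrable μ) fun y => ?_
        exact integral_mono_measure h (ae_of_all _ fun x => hk0 x y)
          ((bddMeasurable_slice hk y).integrable ν)
    _ ≤ energy k ν ν := integral_mono_measure h
        (ae_of_all _ fun y => integral_nonneg fun x => hk0 x y)
        ((bddMeasurable_integral_slice hk ν).integrable ν)

variable {f₀ ψ₀ f₁ ψ₁ f ψ g η : X → ℝ}

/-- Concavity of `α ↦ OT_ε(α, α) - ε m(α)²`. -/
theorem dualValue_self_concave (hε : 0 < ε) (hC : BddMeasurable fun z : X × X => C z.1 z.2)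
    (hsymm : ∀ x y, C x y = C y x) (hpos : IsPositiveKernel (gibbsKernel C ε))
    {s t : ℝ≥0} (hst : s + t = 1)
    (h₀ : IsSelfPotential C φ ε α₀ f₀ ψ₀) (h₁ : IsSelfPotential C φ ε α₁ f₁ ψ₁)
    (h : IsSelfPotential C φ ε (s • α₀ + t • α₁) f ψ) :
    s * (dualValue C ε α₀ α₀ f₀ f₀ ψ₀ ψ₀ - ε * (α₀.mass : ℝ) ^ 2) +
      t * (dualValue C ε α₁ α₁ f₁ f₁ ψ₁ ψ₁ - ε * (α₁.mass : ℝ) ^ 2) ≤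
    dualValue C ε (s • α₀ + t • α₁) (s • α₀ + t • α₁) f f ψ ψ -
      ε * ((s • α₀ + t • α₁).mass : ℝ) ^ 2 := by
  obtain ⟨l, hlm, hl1, hl₀, hl₁⟩ :=
    exists_withDensity_add (s • (α₀ : Measure X)) (t • (α₁ : Measure X))
  set α : FiniteMeasure X := s • α₀ + t • α₁ with hα
  have hαm : (α : Measure X) = s • (α₀ : Measure X) + t • (α₁ : Measure X) := by
    simp only [hα, FiniteMeasure.toMeasure_add, FiniteMeasure.toMeasure_smul]
  rw [← hαm] at hl₀ hl₁
  have hl'm : Measurable fun y => 1 - l y := measurable_const.sub hlm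
  have hlb : BddMeasurable fun x => (l x : ℝ) :=
    ⟨hlm.coe_nnreal_real, 1, fun x => by rw [NNReal.abs_eq]; exact_mod_cast hl1 x⟩
  have hl'b : BddMeasurable fun x => ((1 - l x : ℝ≥0) : ℝ) :=
    ⟨hl'm.coe_nnreal_real, 1, fun x => by
      rw [NNReal.abs_eq]; exact_mod_cast (tsub_le_self : 1 - l x ≤ 1)⟩
  have hsum : ∀ x, (l x : ℝ) + ((1 - l x : ℝ≥0) : ℝ) = 1 := fun x => by
    rw [← NNReal.coe_add, add_tsub_cancel_of_le (hl1 x), NNReal.coe_one]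
  -- Averaging with the pointwise weights `l`, `1 - l` keeps dual feasibility, which is an affine
  -- constraint in `(f, ψ)`, and splits `∫ P dα` exactly into the two given integrals.
  set F : X → ℝ := fun x => l x * f₀ x + (1 - l x : ℝ≥0) * f₁ x with hF
  set P : X → ℝ := fun x => l x * ψ₀ x + (1 - l x : ℝ≥0) * ψ₁ x with hP
  have hFb : BddMeasurable F := (hlb.mul h₀.bdd_left).add (hl'b.mul h₁.bdd_left)
  have hPb : BddMeasurable P := (hlb.mul h₀.bdd_right).add (hl'b.mul h₁.bdd_right)
  have hle : ∀ (x : X) (q : ℝ≥0), ENNReal.ofReal (P x - F x * q) ≤ φ q := by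
    intro x q
    by_cases hq : φ q = ∞
    · rw [hq]; exact le_top
    have e₀ := (ENNReal.ofReal_le_iff_le_toReal hq).1 (h₀.le_map x q)
    have e₁ := (ENNReal.ofReal_le_iff_le_toReal hq).1 (h₁.le_map x q)
    rw [ENNReal.ofReal_le_iff_le_toReal hq]
    calc P x - F x * q = l x * (ψ₀ x - f₀ x * q) + (1 - l x : ℝ≥0) * (ψ₁ x - f₁ x * q) := by
          simp only [hP, hF]; ring
      _ ≤ l x * (φ q).toReal + (1 - l x : ℝ≥0) * (φ q).toReal := by gcongr
      _ = (φ q).toReal := by rw [← add_mul, hsum, one_mul]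
  have hweak : dualValue C ε α α F F P P ≤ dualValue C ε α α f f ψ ψ := by
    have := dualValue_le_otCost (α := α) (β := α) hε hC hFb hFb hPb hPb (ae_of_all _ hle)
      (ae_of_all _ hle)
    rw [h.otCost_eq] at this
    exact_mod_cast this
  have hPint : ∫ x, P x ∂(α : Measure X) =
      s * ∫ x, ψ₀ x ∂(α₀ : Measure X) + t * ∫ x, ψ₁ x ∂(α₁ : Measure X) := by
    have e₀ : s * ∫ x, ψ₀ x ∂(α₀ : Measure X) = ∫ x, l x * ψ₀ x ∂(α : Measure X) := by
      rw [← smul_eq_mul, ← NNReal.smul_def, ← integral_smul_nnreal_measure, hl₀,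
        integral_withDensity_eq_integral_smul hlm]
      rfl
    have e₁ : t * ∫ x, ψ₁ x ∂(α₁ : Measure X) =
        ∫ x, (1 - l x : ℝ≥0) * ψ₁ x ∂(α : Measure X) := by
      rw [← smul_eq_mul, ← NNReal.smul_def, ← integral_smul_nnreal_measure, hl₁,
        integral_withDensity_eq_integral_smul hl'm]
      rfl
    rw [e₀, e₁, ← integral_add ((hlb.mul h₀.bdd_right).integrable _)
      ((hl'b.mul h₁.bdd_right).integrable _)]
  have i₀ := isFiniteMeasure_expMeasure (ε := ε) (α := α₀) h₀.bdd_left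
  have i₁ := isFiniteMeasure_expMeasure (ε := ε) (α := α₁) h₁.bdd_left
  -- Convexity of `exp` bounds the new measure by the mixture; the energy respects this order
  -- because the kernel is nonnegative, and is convex because the kernel is positive.
  have hmono : expMeasure ε α F ≤ s • expMeasure ε α₀ f₀ + t • expMeasure ε α₁ f₁ := by
    have m₀ := (h₀.bdd_left.div_const ε).exp.1.ennreal_ofReal
    have m₁ := (h₁.bdd_left.div_const ε).exp.1.ennreal_ofReal
    have e : s • expMeasure ε α₀ f₀ + t • expMeasure ε α₁ f₁ = (α : Measure X).withDensity
        ((fun x => (l x : ℝ≥0∞)) * (fun x => ENNReal.ofReal (Real.exp (f₀ x / ε))) +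
          (fun x => ((1 - l x : ℝ≥0) : ℝ≥0∞)) *
            fun x => ENNReal.ofReal (Real.exp (f₁ x / ε))) := by
      rw [withDensity_add_left (hlm.coe_nnreal_ennreal.mul m₀),
        withDensity_mul _ hlm.coe_nnreal_ennreal m₀, withDensity_mul _ hl'm.coe_nnreal_ennreal m₁,
        ← hl₀, ← hl₁]
      simp only [ENNReal.smul_def, withDensity_smul_measure]
      rfl
    rw [e]
    refine withDensity_mono (ae_of_all _ fun x => ?_)
    simp only [Pi.add_apply, Pi.mul_apply]
    rw [← ENNReal.ofReal_coe_nnreal (p := l x), ← ENNReal.ofReal_coe_nnreal (p := 1 - l x),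
      ← ENNReal.ofReal_mul (l x).coe_nonneg, ← ENNReal.ofReal_mul (1 - l x).coe_nonneg,
      ← ENNReal.ofReal_add (by positivity) (by positivity)]
    refine ENNReal.ofReal_le_ofReal ?_
    have := convexOn_exp.2 (mem_univ (f₀ x / ε)) (mem_univ (f₁ x / ε)) (l x).coe_nonneg
      (1 - l x).coe_nonneg (hsum x)
    simp only [smul_eq_mul] at this
    refine le_trans (le_of_eq ?_) this
    simp only [hF]
    congr 1
    ring
  have hk := bddMeasurable_gibbsKernel (ε := ε) hC
  have hks : ∀ x y, gibbsKernel C ε x y = gibbsKernel C ε y x :=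
    fun x y => by rw [gibbsKernel, gibbsKernel, hsymm]
  have hen := (energy_mono hk (fun x y => (Real.exp_pos _).le) hmono).trans
    (energy_convex hk hks hpos (expMeasure ε α₀ f₀) (expMeasure ε α₁ f₁) hst)
  refine le_trans ?_ (sub_le_sub_right hweak _)
  rw [dualValue_eq hC hFb hFb, dualValue_eq hC h₀.bdd_left h₀.bdd_left,
    dualValue_eq hC h₁.bdd_left h₁.bdd_left, hPint]
  have := mul_le_mul_of_nonneg_left hen hε.le
  linarith

theorem sinkhornDiv_comm (hC : BddMeasurable fun z : X × X => C z.1 z.2)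
    (hsymm : ∀ x y, C x y = C y x)
    (hα : IsSelfPotential C φ ε α f ψ) (hβ : IsSelfPotential C φ ε β g η) :
    sinkhornDiv C φ ε α β = sinkhornDiv C φ ε β α := by
  rw [sinkhornDiv_eq hα hβ, sinkhornDiv_eq hβ hα, otCost_comm hC hsymm]
  congr 2
  ring

theorem otCost_ne_bot (hε : 0 < ε) (hC : BddMeasurable fun z : X × X => C z.1 z.2)
    (hα : IsSelfPotential C φ ε α f ψ) (hβ : IsSelfPotential C φ ε β g η) :
    otCost C φ ε α β ≠ ⊥ := by
  have h := dualValue_le_otCost (α := α) (β := β) hε hC hα.bdd_left hβ.bdd_left hα.bdd_right hβ.bdd_right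
    (ae_of_all _ hα.le_map) (ae_of_all _ hβ.le_map)
  intro hb
  rw [hb] at h
  exact absurd h (not_le.2 (EReal.bot_lt_coe _))

theorem sinkhornDiv_convex_left (hε : 0 < ε) (hφ : IsEntropyFunction φ)
    (hC : BddMeasurable fun z : X × X => C z.1 z.2)
    (hsymm : ∀ x y, C x y = C y x) (hpos : IsPositiveKernel (gibbsKernel C ε))
    {s t : ℝ≥0} (hst : s + t = 1)
    (h₀ : IsSelfPotential C φ ε α₀ f₀ ψ₀) (h₁ : IsSelfPotential C φ ε α₁ f₁ ψ₁)
    (h : IsSelfPotential C φ ε (s • α₀ + t • α₁) f ψ) (hβ : IsSelfPotential C φ ε β g η) :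
    sinkhornDiv C φ ε (s • α₀ + t • α₁) β ≤
      ((s : ℝ) : EReal) * sinkhornDiv C φ ε α₀ β + ((t : ℝ) : EReal) * sinkhornDiv C φ ε α₁ β := by
  -- Zero weights are separated first, since `0 * ⊤ = 0` in `EReal`; with positive weights an
  -- infinite cost makes the right side `⊤`, no summand being `⊥`.
  rcases eq_or_ne s 0 with rfl | hs
  · obtain rfl : t = 1 := by simpa using hst
    simp
  rcases eq_or_ne t 0 with rfl | ht
  · obtain rfl : s = 1 := by simpa using hst
    simp
  have hs' : (0 : ℝ) < s := NNReal.coe_pos.2 (pos_iff_ne_zero.2 hs)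
  have ht' : (0 : ℝ) < t := NNReal.coe_pos.2 (pos_iff_ne_zero.2 ht)
  have hnb : ∀ (r : ℝ≥0) (α : FiniteMeasure X) (f ψ : X → ℝ), IsSelfPotential C φ ε α f ψ →
      ((r : ℝ) : EReal) * sinkhornDiv C φ ε α β ≠ ⊥ := by
    intro r α f ψ hα hbot
    have := EReal.mul_nonneg (EReal.coe_nonneg.2 r.coe_nonneg)
      (sinkhornDiv_nonneg hε hC hsymm hpos hα hβ)
    rw [hbot] at this
    exact absurd this (by simp)
  by_cases t₀ : otCost C φ ε α₀ β = ⊤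
  · rw [sinkhornDiv_eq h₀ hβ, t₀, EReal.top_add_coe, EReal.coe_mul_top_of_pos hs',
      EReal.top_add_of_ne_bot (hnb t α₁ f₁ ψ₁ h₁)]
    exact le_top
  by_cases t₁ : otCost C φ ε α₁ β = ⊤
  · rw [sinkhornDiv_eq h₁ hβ, t₁, EReal.top_add_coe, EReal.coe_mul_top_of_pos ht',
      EReal.add_top_of_ne_bot (hnb s α₀ f₀ ψ₀ h₀)]
    exact le_top
  obtain ⟨c₀, e₀⟩ : ∃ c : ℝ, otCost C φ ε α₀ β = (c : EReal) :=
    ⟨_, (EReal.coe_toReal t₀ (otCost_ne_bot hε hC h₀ hβ)).symm⟩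
  obtain ⟨c₁, e₁⟩ : ∃ c : ℝ, otCost C φ ε α₁ β = (c : EReal) :=
    ⟨_, (EReal.coe_toReal t₁ (otCost_ne_bot hε hC h₁ hβ)).symm⟩
  have hconv := otCost_convex_left hε hφ hC hst e₀ e₁
  have hconc := dualValue_self_concave hε hC hsymm hpos hst h₀ h₁ h
  rw [sinkhornDiv_eq h hβ, sinkhornDiv_eq h₀ hβ, sinkhornDiv_eq h₁ hβ, e₀, e₁]
  refine (add_le_add_left hconv _).trans ?_
  rw [← EReal.coe_add, ← EReal.coe_add, ← EReal.coe_add, ← EReal.coe_mul, ← EReal.coe_mul,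
    ← EReal.coe_add, EReal.coe_le_coe_iff]
  have hmass : ((s • α₀ + t • α₁).mass : ℝ) = s * α₀.mass + t * α₁.mass := by
    simp [FiniteMeasure.mass, FiniteMeasure.coeFn_add, FiniteMeasure.coeFn_smul]
  rw [hmass] at hconc ⊢
  have ht1 : (t : ℝ) = 1 - s := by rw [eq_sub_iff_add_eq', ← NNReal.coe_add, hst, NNReal.coe_one]
  rw [ht1] at hconc ⊢
  nlinarith

end Convexity

/-! ### Failure of joint convexity -/

section JointConvexity

/-- The entropy function which is `0` on `[0,1]` and `∞` on `(1,∞)`. -/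
def capEntropy (p : ℝ≥0) : ℝ≥0∞ := if p ≤ 1 then 0 else ∞

theorem isEntropyFunction_capEntropy : IsEntropyFunction capEntropy := by
  refine ⟨⟨convex_univ, fun p _ q _ a b _ _ hab => ?_⟩, fun p y hy => ?_, by simp [capEntropy]⟩
  · rcases eq_or_ne a 0 with rfl | ha
    · obtain rfl : b = 1 := by simpa using hab
      simp
    rcases eq_or_ne b 0 with rfl | hb
    · obtain rfl : a = 1 := by simpa using hab
      simp
    by_cases hp : p ≤ 1
    · by_cases hq : q ≤ 1
      · have : a • p + b • q ≤ 1 := by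
          calc a • p + b • q ≤ a • 1 + b • 1 := by gcongr
            _ = 1 := by simpa using hab
        rw [capEntropy, if_pos this]
        exact zero_le
      · simp [capEntropy, hq, ENNReal.smul_def, hb]
    · simp [capEntropy, hp, ENNReal.smul_def, ha]
  · change y < capEntropy p at hy
    by_cases hp : p ≤ 1
    · rw [capEntropy, if_pos hp] at hy
      exact absurd hy not_lt_zero
    · filter_upwards [lt_mem_nhds (not_le.1 hp)] with q hq
      rw [capEntropy, if_neg hp] at hy
      change y < capEntropy q
      rwa [capEntropy, if_neg (not_le.2 hq)]

theorem isPotential_capEntropy_zero {p : ℝ} (hp : p ≤ 1) : IsPotential capEntropy p 0 0 := by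
  refine ⟨by simp, ?_, by simp⟩
  have : p.toNNReal ≤ 1 := Real.toNNReal_le_one.2 hp
  simp [capEntropy, this]

theorem isPotential_capEntropy_one {f : ℝ} (hf : f ≤ 0) : IsPotential capEntropy 1 f f := by
  refine ⟨by simp, by simp [capEntropy], fun q => ?_⟩
  by_cases hq : q ≤ 1
  · have hq' : (q : ℝ) ≤ 1 := by exact_mod_cast hq
    rw [ENNReal.ofReal_of_nonpos (by nlinarith)]
    exact zero_le
  · simp [capEntropy, hq]

variable {X : Type*} [MeasurableSpace X] [MeasurableSingletonClass X] {C : X → X → ℝ} {ε : ℝ}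

/-- The measure `a δ_x`. -/
def diracMass (x : X) (a : ℝ≥0) : FiniteMeasure X := a • ⟨Measure.dirac x, inferInstance⟩

omit [MeasurableSingletonClass X] in
theorem diracMass_coe (x : X) (a : ℝ≥0) :
    (diracMass x a : Measure X) = a • Measure.dirac x := rfl

omit [MeasurableSingletonClass X] in
theorem mass_diracMass (x : X) (a : ℝ≥0) : (diracMass x a).mass = a := by
  rw [FiniteMeasure.mass, ← ENNReal.coe_inj, FiniteMeasure.ennreal_coeFn_eq_coeFn_toMeasure,
    diracMass_coe]
  simp

omit [MeasurableSingletonClass X] in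
theorem smul_diracMass_add (x : X) (s t a b : ℝ≥0) :
    s • diracMass x a + t • diracMass x b = diracMass x (s * a + t * b) := by
  refine Subtype.ext ?_
  change s • a • Measure.dirac x + t • b • Measure.dirac x = (s * a + t * b) • Measure.dirac x
  rw [smul_smul, smul_smul, ← add_smul]

theorem integral_diracMass (x : X) (a : ℝ≥0) (h : X → ℝ) :
    ∫ y, h y ∂(diracMass x a : Measure X) = a * h x := by
  rw [diracMass_coe, integral_smul_nnreal_measure, integral_dirac]
  rfl

theorem ae_diracMass {x : X} {a : ℝ≥0} {p : X → Prop} (h : p x) :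
    ∀ᵐ y ∂(diracMass x a : Measure X), p y := by
  rw [diracMass_coe]
  exact Measure.ae_smul_measure (by rw [ae_dirac_eq]; exact h) a

/-- The constraint is that the plan's marginals stay below `a δ_x` and `b δ_x`, and KL pulls its
mass towards `a b ≥ a`. The optimum therefore has mass `a`: the first constraint is saturated, with
potential `-ε log b`, and the second is slack, with potential `0`. -/
theorem otCost_capEntropy_diracMass (hε : 0 < ε) (hC : BddMeasurable fun z : X × X => C z.1 z.2)
    (hdiag : ∀ x, C x x = 0) (x : X) {a b : ℝ≥0} (ha : 1 ≤ a) (hab : a ≤ b) :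
    otCost C capEntropy ε (diracMass x a) (diracMass x b) =
      ((ε * (a * b - a - a * Real.log b) : ℝ) : EReal) := by
  have ha' : (1 : ℝ) ≤ a := by exact_mod_cast ha
  have hab' : (a : ℝ) ≤ b := by exact_mod_cast hab
  have hb0 : (0 : ℝ) < b := by linarith
  set f : ℝ := -(ε * Real.log b) with hf
  have hf0 : f ≤ 0 := neg_nonpos.2 (mul_nonneg hε.le (Real.log_nonneg (by linarith)))
  have hcf := BddMeasurable.const (Y := X) f
  have hc0 := BddMeasurable.const (Y := X) 0
  have hE : gibbsDensity C ε (fun _ => f) (fun _ => 0) (x, x) = (b : ℝ)⁻¹ := by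
    simp only [gibbsDensity, hdiag, hf, add_zero, sub_zero]
    rw [neg_div, mul_div_cancel_left₀ _ hε.ne', Real.exp_neg, Real.exp_log hb0]
  have hval : dualValue C ε (diracMass x a) (diracMass x b) (fun _ => f) (fun _ => 0)
      (fun _ => f) (fun _ => 0) = ε * (a * b - a - a * Real.log b) := by
    rw [dualValue, integral_prod _ (((BddMeasurable.const 1).sub
      (bddMeasurable_gibbsDensity hC hcf hc0)).integrable _)]
    simp only [integral_diracMass, hE]
    rw [hf]
    field_simp
    ring
  rw [← hval]
  refine le_antisymm ?_ ?_
  · refine otCost_le_dualValue hε hC hcf hc0 hcf hc0 (ae_diracMass ?_) (ae_diracMass ?_)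
    · rw [integral_diracMass, hE, mul_inv_cancel₀ hb0.ne']
      exact isPotential_capEntropy_one hf0
    · rw [integral_diracMass, hE, ← div_eq_mul_inv]
      exact isPotential_capEntropy_zero ((div_le_one hb0).2 hab')
  · exact dualValue_le_otCost hε hC hcf hc0 hcf hc0
      (ae_of_all _ fun _ => (isPotential_capEntropy_one hf0).le_map)
      (ae_of_all _ fun _ => (isPotential_capEntropy_zero le_rfl).le_map)

theorem sinkhornDiv_capEntropy_diracMass (hε : 0 < ε)
    (hC : BddMeasurable fun z : X × X => C z.1 z.2)
    (hdiag : ∀ x, C x x = 0) (x : X) {a b : ℝ≥0} (ha : 1 ≤ a) (hab : a ≤ b) :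
    sinkhornDiv C capEntropy ε (diracMass x a) (diracMass x b) =
      ((ε * ((b - a) / 2 + a * Real.log a / 2 + b * Real.log b / 2 - a * Real.log b) : ℝ) :
        EReal) := by
  rw [sinkhornDiv, otCost_capEntropy_diracMass hε hC hdiag x ha hab,
    otCost_capEntropy_diracMass hε hC hdiag x ha le_rfl,
    otCost_capEntropy_diracMass hε hC hdiag x (ha.trans hab) le_rfl, coe_sub_half_mul,
    ← EReal.coe_add, mass_diracMass, mass_diracMass]
  congr 1
  ring

theorem not_jointly_convex_capEntropy (hε : 0 < ε)
    (hC : BddMeasurable fun z : X × X => C z.1 z.2) (hdiag : ∀ x, C x x = 0) (x : X) :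
    ¬ ∀ (α₀ α₁ β₀ β₁ : FiniteMeasure X) (s t : ℝ≥0), s + t = 1 →
        sinkhornDiv C capEntropy ε (s • α₀ + t • α₁) (s • β₀ + t • β₁) ≤
          ((s : ℝ) : EReal) * sinkhornDiv C capEntropy ε α₀ β₀ +
          ((t : ℝ) : EReal) * sinkhornDiv C capEntropy ε α₁ β₁ := by
  intro h
  -- `(7,7)` has divergence `0` and `(1,2)` has divergence `ε/2`. At the midpoint `(4, 9/2)` the
  -- excess over the average is `(ε/4)(8 log 4 - 7 log(9/2))`, positive because `(9/2)^7 < 4^8`.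
  have h1 := h (diracMass x 7) (diracMass x 1) (diracMass x 7) (diracMass x 2) (1 / 2) (1 / 2)
    (add_halves 1)
  have e1 : (1 / 2 : ℝ≥0) * 7 + 1 / 2 * 1 = 4 := by rw [← NNReal.coe_inj]; push_cast; norm_num
  have e2 : (1 / 2 : ℝ≥0) * 7 + 1 / 2 * 2 = 9 / 2 := by
    rw [← NNReal.coe_inj]; push_cast; norm_num
  have l1 : (1 : ℝ≥0) ≤ 4 := by norm_num
  have l2 : (4 : ℝ≥0) ≤ 9 / 2 := by rw [← NNReal.coe_le_coe]; push_cast; norm_num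
  rw [smul_diracMass_add, smul_diracMass_add, e1, e2,
    sinkhornDiv_capEntropy_diracMass hε hC hdiag x l1 l2,
    sinkhornDiv_capEntropy_diracMass hε hC hdiag x (by norm_num) le_rfl,
    sinkhornDiv_capEntropy_diracMass hε hC hdiag x le_rfl (by norm_num),
    ← EReal.coe_mul, ← EReal.coe_mul, ← EReal.coe_add, EReal.coe_le_coe_iff] at h1
  push_cast at h1
  rw [Real.log_one] at h1
  have h2 : 7 * Real.log (9 / 2) < 8 * Real.log 4 := by
    have h3 : Real.log ((9 / 2) ^ 7) < Real.log (4 ^ 8) :=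
      Real.log_lt_log (by positivity) (by norm_num)
    rw [Real.log_pow, Real.log_pow] at h3
    exact_mod_cast h3
  have h4 : 0 < ε * (8 * Real.log 4 - 7 * Real.log (9 / 2)) := mul_pos hε (by linarith)
  linarith

end JointConvexity

end UnbalancedOT

end

/-! ### The main theorem -/

theorem mainTheorem1 {X : Type*} [MetricSpace X] [CompactSpace X] [Nonempty X]
    [MeasurableSpace X] [BorelSpace X]
    (C : X → X → ℝ) (γ : ℝ) (ε : ℝ)
    (hsymm : ∀ x y, C x y = C y x)
    (hdiag : ∀ x, C x x = 0)
    (hLip : ∀ x y z, |C x z - C y z| ≤ γ * dist x y)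
    (hε : 0 < ε)
    (hpos : UnbalancedOT.IsPositiveKernel (UnbalancedOT.gibbsKernel C ε))
    (huniv : UnbalancedOT.IsUniversalKernel (UnbalancedOT.gibbsKernel C ε)) :
    (∀ φ : ℝ≥0 → ℝ≥0∞, UnbalancedOT.IsEntropyFunction φ →
      -- positivity
      (∀ α β : FiniteMeasure X, 0 ≤ UnbalancedOT.sinkhornDiv C φ ε α β) ∧
      -- definiteness
      (∀ α β : FiniteMeasure X, UnbalancedOT.sinkhornDiv C φ ε α β = 0 ↔ α = β) ∧
      -- convexity in the first argument
      (∀ (α₀ α₁ β : FiniteMeasure X) (s t : ℝ≥0), s + t = 1 →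
        UnbalancedOT.sinkhornDiv C φ ε (s • α₀ + t • α₁) β ≤
          ((s : ℝ) : EReal) * UnbalancedOT.sinkhornDiv C φ ε α₀ β +
          ((t : ℝ) : EReal) * UnbalancedOT.sinkhornDiv C φ ε α₁ β) ∧
      -- convexity in the second argument
      (∀ (α β₀ β₁ : FiniteMeasure X) (s t : ℝ≥0), s + t = 1 →
        UnbalancedOT.sinkhornDiv C φ ε α (s • β₀ + t • β₁) ≤
          ((s : ℝ) : EReal) * UnbalancedOT.sinkhornDiv C φ ε α β₀ +
          ((t : ℝ) : EReal) * UnbalancedOT.sinkhornDiv C φ ε α β₁)) ∧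
    -- joint convexity fails in general
    (∃ φ : ℝ≥0 → ℝ≥0∞, UnbalancedOT.IsEntropyFunction φ ∧
      ¬ ∀ (α₀ α₁ β₀ β₁ : FiniteMeasure X) (s t : ℝ≥0), s + t = 1 →
        UnbalancedOT.sinkhornDiv C φ ε (s • α₀ + t • α₁) (s • β₀ + t • β₁) ≤
          ((s : ℝ) : EReal) * UnbalancedOT.sinkhornDiv C φ ε α₀ β₀ +
          ((t : ℝ) : EReal) * UnbalancedOT.sinkhornDiv C φ ε α₁ β₁) := by
  have hC : UnbalancedOT.BddMeasurable fun z : X × X => C z.1 z.2 :=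
    .of_continuous (UnbalancedOT.continuous_cost hsymm hLip)
  refine ⟨fun φ hφ => ?_, UnbalancedOT.capEntropy, UnbalancedOT.isEntropyFunction_capEntropy,
    UnbalancedOT.not_jointly_convex_capEntropy hε hC hdiag (Classical.arbitrary X)⟩
  choose f ψ hpot using
    UnbalancedOT.exists_isSelfPotential (C := C) hφ hε hsymm hdiag hLip
  have hcomm : ∀ α β : FiniteMeasure X,
      UnbalancedOT.sinkhornDiv C φ ε α β = UnbalancedOT.sinkhornDiv C φ ε β α :=
    fun α β => UnbalancedOT.sinkhornDiv_comm hC hsymm (hpot α) (hpot β)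
  have hconv : ∀ (α₀ α₁ β : FiniteMeasure X) (s t : ℝ≥0), s + t = 1 →
      UnbalancedOT.sinkhornDiv C φ ε (s • α₀ + t • α₁) β ≤
        ((s : ℝ) : EReal) * UnbalancedOT.sinkhornDiv C φ ε α₀ β +
        ((t : ℝ) : EReal) * UnbalancedOT.sinkhornDiv C φ ε α₁ β :=
    fun α₀ α₁ β s t hst => UnbalancedOT.sinkhornDiv_convex_left hε hφ hC hsymm hpos hst
      (hpot α₀) (hpot α₁) (hpot _) (hpot β)
  refine ⟨fun α β => UnbalancedOT.sinkhornDiv_nonneg hε hC hsymm hpos (hpot α) (hpot β),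
    fun α β => ⟨fun h => UnbalancedOT.eq_of_sinkhornDiv_eq_zero hε hC hsymm hpos huniv
      (hpot α) (hpot β) h, ?_⟩, hconv, fun α β₀ β₁ s t hst => ?_⟩
  · rintro rfl
    exact UnbalancedOT.sinkhornDiv_self (hpot α)
  · rw [hcomm α, hcomm α, hcomm α]
    exact hconv β₀ β₁ α s t hst
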